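/- Let $(\Omega,\mathcal F,\mathsf P)$ be a probability space with a filtration $(\mathcal F_s)$, and let $\mathbf w=(\mathbf w^{(1)},\dots,\mathbf w^{(m)})$ be a standard $m$-dimensional Wiener process on $[0,\hat T]$ relative to $(\mathcal F_s)$: $\mathbf w_s$ is $\mathcal F_s$-measurable, $\mathbf w_0=0$ a.s., paths are a.s. continuous, and for $0\le s\le u\le\hat T$ the increment $\mathbf w_u-\mathbf w_s$ is independent of $\mathcal F_s$ with law $N(0,(u-s)I_m)$ (so the components are independent). Let $0\le t<T\le\hat T$. Let $P_j$ be the Legendre polynomials and $$\phi_j(s)=\sqrt{\frac{2j+1}{T-t}}\;P_j\!\left(\Bigl(s-t-\frac{T-t}{2}\Bigr)\frac{2}{T-t}\right),\qquad \zeta_j^{(i)}=\int_t^T\phi_j(s)\,d\mathbf w_s^{(i)},\qquad j=0,1,2,\dots,\ i=1,\dots,m,$$ and for $i_1\ne i_2$ let $$I^{(i_1i_2)}_{T,t}=\int_t^T\!\int_t^s d\mathbf w^{(i_1)}_\tau\,d\mathbf w^{(i_2)}_s,\qquad A^{(i_1i_2)}_{T,t}=\tfrac12\bigl(I^{(i_1i_2)}_{T,t}-I^{(i_2i_1)}_{T,t}\bigr)$$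 be the iterated Itô integral and the Lévy stochastic area. These Itô integrals exist; the $\zeta_j^{(i)}$ ($i=1,\dots,m$, $j=0,1,\dots$) are independent standard Gaussian random variables; and for all $i_1,i_2\in\{1,\dots,m\}$ with $i_1\neq i_2$ $$I^{(i_1i_2)}_{T,t}=\frac{T-t}{2}\left(\zeta_0^{(i_1)}\zeta_0^{(i_2)}+\sum_{i=1}^\infty\frac{1}{\sqrt{4i^2-1}}\Bigl(\zeta_{i-1}^{(i_1)}\zeta_i^{(i_2)}-\zeta_i^{(i_1)}\zeta_{i-1}^{(i_2)}\Bigr)\right)$$ and $$A^{(i_1i_2)}_{T,t}=\frac{T-t}{2}\sum_{i=1}^\infty\frac{1}{\sqrt{4i^2-1}}\Bigl(\zeta_{i-1}^{(i_1)}\zeta_i^{(i_2)}-\zeta_i^{(i_1)}\zeta_{i-1}^{(i_2)}\Bigr),$$ where all partial sums are square integrable and both series converge in mean square. -/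

import Mathlib

open MeasureTheory ProbabilityTheory Filter Topology

/-- `W` is a standard `m`-dimensional Wiener process on the time interval `[0, S]`, relative to the
filtration `𝓕`. The law of the increments (a product of centred Gaussian measures) together with
their independence of the past makes the components of `W` independent. Only the times in `[0, S]`
matter: time is indexed by `ℝ` for convenience. -/
structure IsWienerProcess {Ω : Type*} {mΩ : MeasurableSpace Ω} {m : ℕ}
    (W : Fin m → ℝ → Ω → ℝ) (𝓕 : Filtration ℝ mΩ) (S : ℝ) (P : Measure Ω) : Prop where
  adapted : ∀ i, ∀ s ∈ Set.Icc 0 S, Measurable[𝓕 s] (W i s)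
  zero : ∀ i, ∀ᵐ ω ∂P, W i 0 ω = 0
  law_increment : ∀ s u : ℝ, 0 ≤ s → s ≤ u → u ≤ S →
    HasLaw (fun ω (i : Fin m) ↦ W i u ω - W i s ω)
      (Measure.pi fun _ ↦ gaussianReal 0 (u - s).toNNReal) P
  indep_increment : ∀ s u : ℝ, 0 ≤ s → s ≤ u → u ≤ S →
    Indep (MeasurableSpace.comap (fun ω (i : Fin m) ↦ W i u ω - W i s ω) inferInstance) (𝓕 s) P
  continuous_paths : ∀ i, ∀ᵐ ω ∂P, ContinuousOn (fun s ↦ W i s ω) (Set.Icc 0 S)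

/-- A simple (step) process on `[a, b]`: on `(node k, node (k + 1)]`, `k < n`, it is equal to a
square integrable random variable `coeff k`, measurable with respect to `𝓕 (node k)`. -/
structure SimpleItoProcess {Ω : Type*} {mΩ : MeasurableSpace Ω}
    (𝓕 : Filtration ℝ mΩ) (P : Measure Ω) (a b : ℝ) where
  n : ℕ
  node : ℕ → ℝ
  coeff : ℕ → Ω → ℝ
  node_mono : Monotone node
  node_first : node 0 = a
  node_last : node n = b
  coeff_measurable : ∀ k < n, Measurable[𝓕 (node k)] (coeff k)
  coeff_memLp : ∀ k < n, MemLp (coeff k) 2 P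

/-- The values of a simple process. -/
noncomputable def SimpleItoProcess.val {Ω : Type*} {mΩ : MeasurableSpace Ω}
    {𝓕 : Filtration ℝ mΩ} {P : Measure Ω} {a b : ℝ}
    (V : SimpleItoProcess 𝓕 P a b) (s : ℝ) (ω : Ω) : ℝ :=
  ∑ k ∈ Finset.range V.n, (Set.Ioc (V.node k) (V.node (k + 1))).indicator (fun _ ↦ V.coeff k ω) s

/-- The stochastic integral of a simple process with respect to `w`. -/
noncomputable def SimpleItoProcess.integral {Ω : Type*} {mΩ : MeasurableSpace Ω}
    {𝓕 : Filtration ℝ mΩ} {P : Measure Ω} {a b : ℝ}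
    (V : SimpleItoProcess 𝓕 P a b) (w : ℝ → Ω → ℝ) (ω : Ω) : ℝ :=
  ∑ k ∈ Finset.range V.n, V.coeff k ω * (w (V.node (k + 1)) ω - w (V.node k) ω)

/-- `X` is (a version of) the Itô integral `∫_a^b H_s dw_s`: simple processes approximate `H` in
`L²([a, b] × Ω)`, and their integrals converge to `X` in mean square. -/
def IsItoIntegral {Ω : Type*} {mΩ : MeasurableSpace Ω}
    (𝓕 : Filtration ℝ mΩ) (P : Measure Ω) (w : ℝ → Ω → ℝ) (a b : ℝ)
    (H : ℝ → Ω → ℝ) (X : Ω → ℝ) : Prop :=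
  MemLp X 2 P ∧
  ∃ V : ℕ → SimpleItoProcess 𝓕 P a b,
    Tendsto (fun n ↦ eLpNorm (fun p : ℝ × Ω ↦ (V n).val p.1 p.2 - H p.1 p.2) 2
      ((volume.restrict (Set.Ioc a b)).prod P)) atTop (𝓝 0) ∧
    Tendsto (fun n ↦ eLpNorm (fun ω ↦ (V n).integral w ω - X ω) 2 P) atTop (𝓝 0)

open scoped Classical in
/-- The Itô integral `∫_a^b H_s dw_s` (and `0` if `H` is not integrable). -/
noncomputable def itoIntegral {Ω : Type*} {mΩ : MeasurableSpace Ω}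
    (𝓕 : Filtration ℝ mΩ) (P : Measure Ω) (w : ℝ → Ω → ℝ) (a b : ℝ)
    (H : ℝ → Ω → ℝ) : Ω → ℝ :=
  if h : ∃ X, IsItoIntegral 𝓕 P w a b H X then h.choose else 0

/-- `X` is (a version of) the iterated Itô integral `∫_a^b ∫_a^s dv_τ dw_s`. As usual, the inner
integral is, as a process in `s`, the version with almost surely continuous paths. -/
def IsIteratedItoIntegral {Ω : Type*} {mΩ : MeasurableSpace Ω}
    (𝓕 : Filtration ℝ mΩ) (P : Measure Ω) (v w : ℝ → Ω → ℝ) (a b : ℝ) (X : Ω → ℝ) : Prop :=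
  ∃ Y : ℝ → Ω → ℝ,
    (∀ s ∈ Set.Icc a b, IsItoIntegral 𝓕 P v a s (fun _ _ ↦ 1) (Y s)) ∧
    (∀ᵐ ω ∂P, ContinuousOn (fun s ↦ Y s ω) (Set.Icc a b)) ∧
    IsItoIntegral 𝓕 P w a b Y X

open scoped Classical in
/-- The iterated Itô integral `∫_a^b ∫_a^s dv_τ dw_s` (and `0` if it does not exist). -/
noncomputable def iteratedItoIntegral {Ω : Type*} {mΩ : MeasurableSpace Ω}
    (𝓕 : Filtration ℝ mΩ) (P : Measure Ω) (v w : ℝ → Ω → ℝ) (a b : ℝ) : Ω → ℝ :=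
  if h : ∃ X, IsIteratedItoIntegral 𝓕 P v w a b X then h.choose else 0

/-- The Lévy stochastic area `A = (I^{(vw)} - I^{(wv)}) / 2` on `[a, b]`. -/
noncomputable def levyArea {Ω : Type*} {mΩ : MeasurableSpace Ω}
    (𝓕 : Filtration ℝ mΩ) (P : Measure Ω) (v w : ℝ → Ω → ℝ) (a b : ℝ) (ω : Ω) : ℝ :=
  1 / 2 * (iteratedItoIntegral 𝓕 P v w a b ω - iteratedItoIntegral 𝓕 P w v a b ω)

/-- The Legendre polynomial `P_j`, by Rodrigues' formula. -/
noncomputable def legendreP (j : ℕ) : Polynomial ℝ :=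
  Polynomial.C (1 / (2 ^ j * (j.factorial : ℝ))) *
    Polynomial.derivative^[j] ((Polynomial.X ^ 2 - 1) ^ j)

/-- The normalized Legendre polynomials on `[t, T]`. -/
noncomputable def legendrePhi (t T : ℝ) (j : ℕ) (s : ℝ) : ℝ :=
  √((2 * (j : ℝ) + 1) / (T - t)) *
    (legendreP j).eval ((s - t - (T - t) / 2) * (2 / (T - t)))

/-- `ζ_j = ∫_t^T φ_j(s) dw_s`, with `φ_j` the normalized Legendre polynomials on `[t, T]`. -/
noncomputable def legendreZeta {Ω : Type*} {mΩ : MeasurableSpace Ω}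
    (𝓕 : Filtration ℝ mΩ) (P : Measure Ω) (w : ℝ → Ω → ℝ) (t T : ℝ) (j : ℕ) : Ω → ℝ :=
  itoIntegral 𝓕 P w t T (fun s _ ↦ legendrePhi t T j s)

/-- `X` is the limit in mean square of the sequence `S` of random variables. -/
def IsMeanSquareLimit {Ω : Type*} {mΩ : MeasurableSpace Ω}
    (P : Measure Ω) (S : ℕ → Ω → ℝ) (X : Ω → ℝ) : Prop :=
  (∀ n, MemLp (S n) 2 P) ∧ MemLp X 2 P ∧
    Tendsto (fun n ↦ eLpNorm (fun ω ↦ S n ω - X ω) 2 P) atTop (𝓝 0)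

/-!
The proof computes the mean square error of the partial sums and shows that it tends to zero; the
completeness of the Legendre polynomials is not needed.

Write `h = T - t`. Formally, `I = ∬_{x < s} dw¹_x dw²_s`, `ζ¹_j ζ²_k = ∬ φ_j(x) φ_k(s) dw¹_x dw²_s`,
and `K ↦ ∬ K dw¹ dw²` is an isometry of `L²([t, T]²)`, because the two components are independent.
So for a finite set `F` of index pairs, with `C_{jk} = ∫ φ_k(s) ∫_t^s φ_j(x) dx ds`, the squared
distance of `I` from `∑_F C_{jk} ζ¹_j ζ²_k` is that of the indicator function of the triangle from
`∑_F C_{jk} φ_j ⊗ φ_k`, which is `h² / 2 - ∑_F C_{jk}²` by the orthonormality of the `φ_j`. The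
recurrence `(2j + 3) Q_{j+1} = P_{j+2} - P_j` for the antiderivatives `Q_j` of the Legendre
polynomials, which follows from Rodrigues' formula (`legendreQ_succ_eq`), gives the coefficients
`C_{00} = h / 2` and `C_{i-1,i} = -C_{i,i-1} = (h / 2) / √(4 i² - 1)`. Since
`2 / (4 i² - 1) = 1 / (2i - 1) - 1 / (2i + 1)`, the sum of their squares telescopes
(`sum_triangleCoeff_sq`), and the squared error of the `n`-th partial sum is at most
`h² / (4 (2n + 1))`.

No double stochastic integral has to be constructed for this. On a uniform partition, `I` and the
`ζ_j` are replaced by their Riemann sums, and the isometry becomes the orthogonality of the products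
`Δw¹_l Δw²_k` of increments (`integral_gridIncrement_mul_mul`); the sums of squares that result are
Riemann sums (`tendsto_sum_sq_triangle_sub`). The bound passes to the limit by Fatou's lemma, along
a subsequence on which all Riemann sums converge almost surely
(`IsIteratedItoIntegral.eLpNorm_sub_le`).

That the Riemann sums converge to the Itô integrals, whatever versions of these are chosen, is a
consequence of the Itô isometry for the difference of two simple processes
(`SimpleItoProcess.eLpNorm_integral_sub`), which also gives existence. The inner integral of the
iterated integral is indistinguishable from the increment `w_s - w_t`, by the continuity of paths.
Finally, the joint characteristic function of the increments over a partition, computed by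
conditioning on the past, shows that they are independent Gaussian variables, and its limit shows
the same for the `ζ_j` (`IsWienerProcess.legendre_gaussian`).
-/

open MeasureTheory ProbabilityTheory Filter Topology

/-! ### Legendre polynomials and their antiderivatives -/

/-- The antiderivative of the Legendre polynomial `P_j` that vanishes at `-1`. -/
noncomputable def legendreQ : ℕ → Polynomial ℝ
  | 0 => Polynomial.X + 1
  | j + 1 => Polynomial.C (1 / (2 ^ (j + 1) * ((j + 1).factorial : ℝ))) *
      Polynomial.derivative^[j] ((Polynomial.X ^ 2 - 1) ^ (j + 1))

/-- Integration over `[-1, 1]`, as a linear functional on polynomials. -/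
noncomputable def polyIntegral : Polynomial ℝ →ₗ[ℝ] ℝ where
  toFun p := ∫ x in (-1 : ℝ)..1, p.eval x
  map_add' p q := by
    simp only [Polynomial.eval_add]
    exact intervalIntegral.integral_add (p.continuous.intervalIntegrable _ _)
      (q.continuous.intervalIntegrable _ _)
  map_smul' c p := by simp

theorem polyIntegral_apply (p : Polynomial ℝ) :
    polyIntegral p = ∫ x in (-1 : ℝ)..1, p.eval x := rfl

theorem polyIntegral_mul_derivative (p q : Polynomial ℝ) (h₁ : (p * q).eval 1 = 0)
    (h₂ : (p * q).eval (-1) = 0) :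
    polyIntegral (p * q.derivative) = -polyIntegral (p.derivative * q) := by
  have h := intervalIntegral.integral_mul_deriv_eq_deriv_mul (a := (-1 : ℝ)) (b := 1)
    (fun x _ ↦ p.hasDerivAt x) (fun x _ ↦ q.hasDerivAt x)
    (p.derivative.continuous.intervalIntegrable _ _)
    (q.derivative.continuous.intervalIntegrable _ _)
  rw [Polynomial.eval_mul] at h₁ h₂
  simp only [polyIntegral_apply, Polynomial.eval_mul]
  rw [h, h₁, h₂]
  simp

theorem eval_iterate_derivative_eq_zero {i n : ℕ} (hi : i < n) {x : ℝ} (hx : x ^ 2 = 1) :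
    (Polynomial.derivative^[i] ((Polynomial.X ^ 2 - 1 : Polynomial ℝ) ^ n)).eval x = 0 := by
  obtain ⟨r, hr⟩ := Polynomial.pow_sub_dvd_iterate_derivative_pow
    (Polynomial.X ^ 2 - 1 : Polynomial ℝ) n i
  rw [hr]
  simp [hx, Nat.sub_ne_zero_of_lt hi]

theorem derivative_legendreQ (j : ℕ) : (legendreQ j).derivative = legendreP j := by
  cases j with
  | zero => simp [legendreQ, legendreP]
  | succ j =>
    rw [legendreQ, legendreP, Polynomial.derivative_C_mul, Function.iterate_succ_apply']

/-- For `j ≥ 1`, the antiderivative of `P_j` vanishes at both ends `±1`. -/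
theorem eval_legendreQ_succ (j : ℕ) {x : ℝ} (hx : x ^ 2 = 1) :
    (legendreQ (j + 1)).eval x = 0 := by
  rw [legendreQ, Polynomial.eval_mul, eval_iterate_derivative_eq_zero (Nat.lt_succ_self j) hx,
    mul_zero]

theorem eval_legendreQ_neg_one (j : ℕ) : (legendreQ j).eval (-1) = 0 := by
  cases j with
  | zero => simp [legendreQ]
  | succ j => exact eval_legendreQ_succ j (by norm_num)

theorem legendreP_zero : legendreP 0 = 1 := by simp [legendreP]

theorem legendreP_one : legendreP 1 = Polynomial.X := by
  have h : Polynomial.derivative ((Polynomial.X : Polynomial ℝ) ^ 2 - 1) =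
      Polynomial.C 2 * Polynomial.X := by
    have h2 : Polynomial.C (2 : ℝ) = 2 := map_ofNat _ 2
    simp [h2, one_add_one_eq_two]
  rw [legendreP, pow_one, pow_one, Function.iterate_one, h, ← mul_assoc, ← Polynomial.C_mul]
  norm_num

theorem legendreQ_zero : legendreQ 0 = legendreP 1 + legendreP 0 := by
  rw [legendreP_zero, legendreP_one, legendreQ]

/-- The recurrence `(2j + 3) Q_{j+1} = P_{j+2} - P_j`: apply the `j`-th derivative to
`((x² - 1)^{j+2})'' = 2 (j + 2) ((2j + 3) (x² - 1)^{j+1} + 2 (j + 1) (x² - 1)^j)`. -/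
theorem legendreQ_succ_eq (j : ℕ) :
    (2 * (j : ℝ) + 3) • legendreQ (j + 1) = legendreP (j + 2) - legendreP j := by
  have key : Polynomial.derivative (Polynomial.derivative
      ((Polynomial.X ^ 2 - 1 : Polynomial ℝ) ^ (j + 2))) =
      Polynomial.C (2 * ((j : ℝ) + 2) * (2 * j + 3)) * (Polynomial.X ^ 2 - 1) ^ (j + 1) +
      Polynomial.C (2 * ((j : ℝ) + 2) * (2 * (j + 1))) * (Polynomial.X ^ 2 - 1) ^ j := by
    have h2 : Polynomial.C (2 : ℝ) = 2 := map_ofNat _ 2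
    have h3 : Polynomial.C (3 : ℝ) = 3 := map_ofNat _ 3
    simp [Polynomial.derivative_pow, h2, h3]
    ring
  have e : Polynomial.derivative^[j + 2] ((Polynomial.X ^ 2 - 1 : Polynomial ℝ) ^ (j + 2)) =
      Polynomial.C (2 * ((j : ℝ) + 2) * (2 * j + 3)) *
        Polynomial.derivative^[j] ((Polynomial.X ^ 2 - 1) ^ (j + 1)) +
      Polynomial.C (2 * ((j : ℝ) + 2) * (2 * (j + 1))) *
        Polynomial.derivative^[j] ((Polynomial.X ^ 2 - 1) ^ j) := by
    rw [Function.iterate_add_apply, Function.iterate_succ_apply, Function.iterate_one, key,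
      iterate_map_add, Polynomial.iterate_derivative_C_mul,
      Polynomial.iterate_derivative_C_mul]
  have hf : ((j.factorial : ℕ) : ℝ) ≠ 0 := by positivity
  rw [legendreQ, legendreP, legendreP, e, Polynomial.smul_eq_C_mul, mul_add, ← mul_assoc,
    ← mul_assoc, ← mul_assoc, ← Polynomial.C_mul, ← Polynomial.C_mul, ← Polynomial.C_mul,
    Nat.factorial_succ (j + 1), Nat.factorial_succ j]
  push_cast
  have h1 : (1 / (2 ^ (j + 2) * (((j : ℝ) + 1 + 1) * (((j : ℝ) + 1) * (j.factorial : ℝ)))) *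
      (2 * ((j : ℝ) + 2) * (2 * (j + 1)))) = 1 / (2 ^ j * (j.factorial : ℝ)) := by
    field_simp; ring
  have h2 : (1 / (2 ^ (j + 2) * (((j : ℝ) + 1 + 1) * (((j : ℝ) + 1) * (j.factorial : ℝ)))) *
      (2 * ((j : ℝ) + 2) * (2 * j + 3))) =
      (2 * (j : ℝ) + 3) * (1 / (2 ^ (j + 1) * (((j : ℝ) + 1) * (j.factorial : ℝ)))) := by
    field_simp; ring
  rw [h1, h2]
  ring

/-- Repeated integration by parts: the boundary terms vanish, because `(x² - 1) ^ n` has zeros of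
order `n` at `±1`. -/
theorem polyIntegral_mul_iterate_derivative {n : ℕ} : ∀ {i : ℕ} (_ : i ≤ n) (q : Polynomial ℝ)
    (_ : Polynomial.derivative^[i] q = 0),
    polyIntegral (q * Polynomial.derivative^[i] ((Polynomial.X ^ 2 - 1) ^ n)) = 0 := by
  intro i
  induction i with
  | zero => intro _ q hq; simp_all
  | succ i ih =>
    intro hi q hq
    rw [Function.iterate_succ_apply', polyIntegral_mul_derivative,
      ih (by omega) _ (by rwa [← Function.iterate_succ_apply]), neg_zero] <;>
    rw [Polynomial.eval_mul, eval_iterate_derivative_eq_zero (by omega) (by norm_num), mul_zero]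

theorem natDegree_legendreP_le (j : ℕ) : (legendreP j).natDegree ≤ j := by
  refine (Polynomial.natDegree_C_mul_le _ _).trans
    ((Polynomial.natDegree_iterate_derivative _ _).trans ?_)
  have h : ((Polynomial.X ^ 2 - 1 : Polynomial ℝ) ^ j).natDegree ≤ j * 2 :=
    Polynomial.natDegree_pow_le_of_le j (by compute_degree)
  omega

theorem polyIntegral_legendreP_of_lt {i j : ℕ} (hij : i < j) :
    polyIntegral (legendreP i * legendreP j) = 0 := by
  conv_lhs => rw [legendreP.eq_1 j, mul_left_comm, ← Polynomial.smul_eq_C_mul, map_smul]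
  rw [polyIntegral_mul_iterate_derivative le_rfl _
    (Polynomial.iterate_derivative_eq_zero ((natDegree_legendreP_le i).trans_lt hij)), smul_zero]

theorem polyIntegral_legendreP_of_ne {i j : ℕ} (hij : i ≠ j) :
    polyIntegral (legendreP i * legendreP j) = 0 := by
  rcases lt_or_gt_of_ne hij with h | h
  · exact polyIntegral_legendreP_of_lt h
  · rw [mul_comm]; exact polyIntegral_legendreP_of_lt h

theorem polyIntegral_legendreQ_succ_mul (j : ℕ) :
    (2 * (j : ℝ) + 3) * polyIntegral (legendreP j * legendreQ (j + 1)) =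
      -polyIntegral (legendreP j * legendreP j) := by
  rw [← smul_eq_mul, ← map_smul, ← mul_smul_comm, legendreQ_succ_eq, mul_sub, map_sub,
    polyIntegral_legendreP_of_ne (by omega), zero_sub]

theorem polyIntegral_legendreP_succ_mul (j : ℕ) :
    polyIntegral (legendreP (j + 1) * legendreQ j) =
      -polyIntegral (legendreP j * legendreQ (j + 1)) := by
  rw [← derivative_legendreQ (j + 1), ← derivative_legendreQ j, mul_comm,
    polyIntegral_mul_derivative] <;>
  rw [Polynomial.eval_mul, eval_legendreQ_succ j (by norm_num), mul_zero]

/-- The recurrence for `Q_j` and orthogonality; for `j = 0`, `Q_0 = P_1 + P_0` replaces the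
recurrence. -/
theorem polyIntegral_legendreP_succ_mul' (j : ℕ) :
    (2 * (j : ℝ) + 1) * polyIntegral (legendreP (j + 1) * legendreQ j) =
      polyIntegral (legendreP (j + 1) * legendreP (j + 1)) := by
  cases j with
  | zero =>
    rw [legendreQ_zero, mul_add, map_add, polyIntegral_legendreP_of_ne (i := 0 + 1) (j := 0)]
      <;> simp
  | succ j =>
    have h : (2 * ((j + 1 : ℕ) : ℝ) + 1) = 2 * (j : ℝ) + 3 := by push_cast; ring
    rw [h, ← smul_eq_mul, ← map_smul, ← mul_smul_comm, legendreQ_succ_eq, mul_sub, map_sub,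
      polyIntegral_legendreP_of_ne (i := j + 1 + 1) (j := j) (by omega), sub_zero]

/-- The squared norm of `P_j` is `2 / (2j + 1)`: integrating `P_{j+1} Q_j` by parts relates the
squared norms of `P_{j+1}` and `P_j`. -/
theorem polyIntegral_legendreP_sq (j : ℕ) :
    polyIntegral (legendreP j * legendreP j) = 2 / (2 * (j : ℝ) + 1) := by
  induction j with
  | zero => simp [legendreP_zero, polyIntegral_apply]; norm_num
  | succ j ih =>
    rw [← polyIntegral_legendreP_succ_mul', polyIntegral_legendreP_succ_mul]
    have h := polyIntegral_legendreQ_succ_mul j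
    rw [ih] at h
    have h3 : (2 * (j : ℝ) + 3) ≠ 0 := by positivity
    have : polyIntegral (legendreP j * legendreQ (j + 1)) =
        -(2 / (2 * (j : ℝ) + 1)) / (2 * (j : ℝ) + 3) := by
      field_simp at h ⊢; linarith
    rw [this]
    push_cast
    field_simp
    ring

theorem polyIntegral_legendreP_mul_legendreQ_succ (j : ℕ) :
    polyIntegral (legendreP j * legendreQ (j + 1)) =
      -(2 / ((2 * (j : ℝ) + 1) * (2 * (j : ℝ) + 3))) := by
  have h := polyIntegral_legendreQ_succ_mul j
  rw [polyIntegral_legendreP_sq] at h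
  field_simp at h ⊢
  linarith

/-! ### The normalized Legendre polynomials on `[t, T]` -/

theorem continuous_legendrePhi (t T : ℝ) (j : ℕ) : Continuous (legendrePhi t T j) := by
  unfold legendrePhi
  have := (legendreP j).continuous
  fun_prop

/-- The affine substitution that maps `[t, T]` to `[-1, 1]`. -/
theorem integral_eval_affine {t T : ℝ} (htT : t < T) (p : Polynomial ℝ) :
    ∫ s in t..T, p.eval ((s - t - (T - t) / 2) * (2 / (T - t))) =
      (T - t) / 2 * polyIntegral p := by
  have hh : T - t ≠ 0 := by linarith
  have hc : 2 / (T - t) ≠ 0 := by positivity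
  have h := intervalIntegral.integral_comp_mul_add (a := t) (b := T) (fun x ↦ p.eval x) hc
    (-(t + (T - t) / 2) * (2 / (T - t)))
  have e1 : 2 / (T - t) * t + -(t + (T - t) / 2) * (2 / (T - t)) = -1 := by field_simp; ring
  have e2 : 2 / (T - t) * T + -(t + (T - t) / 2) * (2 / (T - t)) = 1 := by field_simp; ring
  rw [e1, e2, ← polyIntegral_apply, smul_eq_mul, inv_div] at h
  rw [← h]
  congr 1 with s
  congr 1
  ring

theorem integral_legendrePhi_mul {t T : ℝ} (htT : t < T) (i j : ℕ) :
    ∫ s in t..T, legendrePhi t T i s * legendrePhi t T j s = if i = j then 1 else 0 := by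
  have hh : 0 < T - t := by linarith
  have e : ∀ s, legendrePhi t T i s * legendrePhi t T j s =
      (√((2 * (i : ℝ) + 1) / (T - t)) * √((2 * (j : ℝ) + 1) / (T - t))) *
      (legendreP i * legendreP j).eval ((s - t - (T - t) / 2) * (2 / (T - t))) := by
    intro s; simp only [legendrePhi, Polynomial.eval_mul]; ring
  simp only [e]
  rw [intervalIntegral.integral_const_mul, integral_eval_affine htT]
  split_ifs with hij
  · subst hij
    rw [Real.mul_self_sqrt (by positivity), polyIntegral_legendreP_sq]
    field_simp
  · rw [polyIntegral_legendreP_of_ne hij]; simp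

theorem integral_legendrePhi {t T : ℝ} (htT : t < T) (j : ℕ) (s : ℝ) :
    ∫ x in t..s, legendrePhi t T j x = √((2 * (j : ℝ) + 1) / (T - t)) * ((T - t) / 2) *
      (legendreQ j).eval ((s - t - (T - t) / 2) * (2 / (T - t))) := by
  have hh : T - t ≠ 0 := by linarith
  have hd : ∀ x, HasDerivAt (fun s ↦ √((2 * (j : ℝ) + 1) / (T - t)) * ((T - t) / 2) *
      (legendreQ j).eval ((s - t - (T - t) / 2) * (2 / (T - t)))) (legendrePhi t T j x) x := by
    intro x
    have h1 : HasDerivAt (fun s ↦ (s - t - (T - t) / 2) * (2 / (T - t))) (2 / (T - t)) x := by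
      simpa using (((hasDerivAt_id x).sub_const t).sub_const ((T - t) / 2)).mul_const
        (2 / (T - t))
    convert! (((legendreQ j).hasDerivAt _).comp x h1).const_mul
      (√((2 * (j : ℝ) + 1) / (T - t)) * ((T - t) / 2)) using 1
    rw [derivative_legendreQ, legendrePhi]
    field_simp
  rw [intervalIntegral.integral_eq_sub_of_hasDerivAt (fun x _ ↦ hd x)
    ((continuous_legendrePhi t T j).intervalIntegrable _ _)]
  have e1 : (t - t - (T - t) / 2) * (2 / (T - t)) = -1 := by field_simp; ring
  simp only [e1, eval_legendreQ_neg_one, mul_zero, sub_zero]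

theorem integral_legendrePhi_mul_integral {t T : ℝ} (htT : t < T) (i j : ℕ) :
    ∫ s in t..T, legendrePhi t T j s * ∫ x in t..s, legendrePhi t T i x =
      √((2 * (i : ℝ) + 1) * (2 * (j : ℝ) + 1)) * ((T - t) / 4) *
        polyIntegral (legendreP j * legendreQ i) := by
  have hh : 0 < T - t := by linarith
  have e : ∀ s, legendrePhi t T j s * ∫ x in t..s, legendrePhi t T i x =
      (√((2 * (i : ℝ) + 1) / (T - t)) * √((2 * (j : ℝ) + 1) / (T - t)) * ((T - t) / 2)) *
      (legendreP j * legendreQ i).eval ((s - t - (T - t) / 2) * (2 / (T - t))) := by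
    intro s; rw [integral_legendrePhi htT]; simp only [legendrePhi, Polynomial.eval_mul]; ring
  simp only [e]
  rw [intervalIntegral.integral_const_mul, integral_eval_affine htT,
    ← Real.sqrt_mul (by positivity), div_mul_div_comm, Real.sqrt_div (by positivity),
    Real.sqrt_mul_self hh.le]
  field_simp
  ring

theorem integral_legendrePhi_zero_zero {t T : ℝ} (htT : t < T) :
    ∫ s in t..T, legendrePhi t T 0 s * ∫ x in t..s, legendrePhi t T 0 x = (T - t) / 2 := by
  rw [integral_legendrePhi_mul_integral htT, legendreQ_zero, mul_add (legendreP 0), map_add,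
    polyIntegral_legendreP_of_ne (by omega), polyIntegral_legendreP_sq]
  simp
  ring

theorem integral_legendrePhi_succ_left {t T : ℝ} (htT : t < T) (j : ℕ) :
    ∫ s in t..T, legendrePhi t T j s * ∫ x in t..s, legendrePhi t T (j + 1) x =
      -((T - t) / 2 * (1 / √(4 * ((j : ℝ) + 1) ^ 2 - 1))) := by
  rw [integral_legendrePhi_mul_integral htT, polyIntegral_legendreP_mul_legendreQ_succ]
  have e : (2 * ((j + 1 : ℕ) : ℝ) + 1) * (2 * (j : ℝ) + 1) = 4 * ((j : ℝ) + 1) ^ 2 - 1 := by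
    push_cast; ring
  have e' : (2 * (j : ℝ) + 1) * (2 * (j : ℝ) + 3) = 4 * ((j : ℝ) + 1) ^ 2 - 1 := by ring
  have hpos : 0 < 4 * ((j : ℝ) + 1) ^ 2 - 1 := by rw [← e']; positivity
  rw [e, e']
  have hs := Real.sq_sqrt hpos.le
  have hs' : 0 < √(4 * ((j : ℝ) + 1) ^ 2 - 1) := Real.sqrt_pos.2 hpos
  set r := √(4 * ((j : ℝ) + 1) ^ 2 - 1)
  rw [← hs]
  field_simp
  ring

theorem integral_legendrePhi_succ_right {t T : ℝ} (htT : t < T) (j : ℕ) :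
    ∫ s in t..T, legendrePhi t T (j + 1) s * ∫ x in t..s, legendrePhi t T j x =
      (T - t) / 2 * (1 / √(4 * ((j : ℝ) + 1) ^ 2 - 1)) := by
  rw [← neg_neg ((T - t) / 2 * _), ← integral_legendrePhi_succ_left htT,
    integral_legendrePhi_mul_integral htT, integral_legendrePhi_mul_integral htT,
    polyIntegral_legendreP_succ_mul, mul_comm (2 * ((j + 1 : ℕ) : ℝ) + 1)]
  ring

/-! ### Riemann sums over uniform partitions -/

/-- The mesh of the uniform partition of `[t, T]` into `n + 1` intervals. -/
noncomputable def gridMesh (t T : ℝ) (n : ℕ) : ℝ := (T - t) / ((n : ℝ) + 1)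

/-- The nodes of the uniform partition of `[t, T]` into `n + 1` intervals. -/
noncomputable def gridNode (t T : ℝ) (n k : ℕ) : ℝ := t + k * gridMesh t T n

theorem gridMesh_pos {t T : ℝ} (htT : t < T) (n : ℕ) : 0 < gridMesh t T n :=
  div_pos (by linarith) (by positivity)

theorem gridNode_zero (t T : ℝ) (n : ℕ) : gridNode t T n 0 = t := by simp [gridNode]

theorem gridNode_last (t T : ℝ) (n : ℕ) : gridNode t T n (n + 1) = T := by
  have : (n : ℝ) + 1 ≠ 0 := by positivity
  rw [gridNode, gridMesh]; push_cast; field_simp; ring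

theorem gridNode_succ (t T : ℝ) (n k : ℕ) :
    gridNode t T n (k + 1) = gridNode t T n k + gridMesh t T n := by
  simp only [gridNode]; push_cast; ring

theorem gridNode_mono {t T : ℝ} (htT : t < T) (n : ℕ) : Monotone (gridNode t T n) :=
  monotone_nat_of_le_succ fun k ↦ by
    rw [gridNode_succ]; linarith [gridMesh_pos htT n]

theorem gridNode_mem {t T : ℝ} (htT : t < T) {n k : ℕ} (hk : k ≤ n + 1) :
    gridNode t T n k ∈ Set.Icc t T :=
  ⟨(gridNode_zero t T n).symm.trans_le (gridNode_mono htT n (Nat.zero_le k)),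
    (gridNode_mono htT n hk).trans_eq (gridNode_last t T n)⟩

theorem tendsto_gridMesh (t T : ℝ) : Tendsto (gridMesh t T) atTop (𝓝 0) :=
  tendsto_const_nhds.div_atTop (tendsto_natCast_atTop_atTop.atTop_add tendsto_const_nhds)

theorem card_mul_gridMesh (t T : ℝ) (n : ℕ) : ((n : ℝ) + 1) * gridMesh t T n = T - t := by
  have : (n : ℝ) + 1 ≠ 0 := by positivity
  rw [gridMesh]; field_simp

theorem eventually_grid_close {t T : ℝ} (htT : t < T) {f : ℝ → ℝ} (hf : Continuous f) {ε : ℝ}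
    (hε : 0 < ε) : ∀ᶠ n in atTop, ∀ k < n + 1,
      ∀ x ∈ Set.Icc (gridNode t T n k) (gridNode t T n (k + 1)),
        |f (gridNode t T n k) - f x| ≤ ε := by
  have huc := isCompact_Icc (a := t) (b := T) |>.uniformContinuousOn_of_continuous hf.continuousOn
  obtain ⟨d, hd, h⟩ := Metric.uniformContinuousOn_iff_le.1 huc ε hε
  filter_upwards [(tendsto_gridMesh t T).eventually_lt_const hd] with n hn k hk x hx
  have hk0 := gridNode_mem htT (n := n) (k := k) (by omega)
  have hk1 := gridNode_mem htT (n := n) (k := k + 1) (by omega)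
  refine h _ hk0 x ⟨hk0.1.trans hx.1, hx.2.trans hk1.2⟩ ?_
  rw [gridNode_succ] at hx
  rw [Real.dist_eq, abs_le]
  constructor <;> linarith [hx.1, hx.2]

/-- The Riemann sums converge to the integrals over `[t, s_k]`, uniformly in the node `s_k`. -/
theorem eventually_riemann_sum_close {t T : ℝ} (htT : t < T) {f : ℝ → ℝ} (hf : Continuous f)
    {ε : ℝ} (hε : 0 < ε) : ∀ᶠ n in atTop, ∀ k ≤ n + 1,
      |gridMesh t T n * ∑ l ∈ Finset.range k, f (gridNode t T n l) -
        ∫ x in t..gridNode t T n k, f x| ≤ ε := by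
  have hh : 0 < T - t := by linarith
  filter_upwards [eventually_grid_close htT hf (div_pos hε hh)] with n hn k hk
  have hδ := gridMesh_pos htT n
  have key : ∀ l < n + 1, |gridMesh t T n * f (gridNode t T n l) -
      ∫ x in gridNode t T n l..gridNode t T n (l + 1), f x| ≤ ε / (T - t) * gridMesh t T n := by
    intro l hl
    have e : gridMesh t T n * f (gridNode t T n l) -
        ∫ x in gridNode t T n l..gridNode t T n (l + 1), f x =
        ∫ x in gridNode t T n l..gridNode t T n (l + 1), (f (gridNode t T n l) - f x) := by
      rw [intervalIntegral.integral_sub (by simp) (hf.intervalIntegrable _ _),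
        intervalIntegral.integral_const, gridNode_succ, add_sub_cancel_left, smul_eq_mul]
    rw [e]
    have hle := gridNode_mono htT n (Nat.le_succ l)
    have := intervalIntegral.norm_integral_le_of_norm_le_const
      (a := gridNode t T n l) (b := gridNode t T n (l + 1))
      (f := fun x ↦ f (gridNode t T n l) - f x) (C := ε / (T - t)) (fun x hx ↦ by
        rw [Set.uIoc_of_le hle] at hx
        exact hn l hl x ⟨hx.1.le, hx.2⟩)
    rwa [Real.norm_eq_abs, abs_of_nonneg (sub_nonneg.2 hle), gridNode_succ,
      add_sub_cancel_left, ← gridNode_succ] at this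
  have hsum : ∫ x in t..gridNode t T n k, f x = ∑ l ∈ Finset.range k,
      ∫ x in gridNode t T n l..gridNode t T n (l + 1), f x := by
    rw [intervalIntegral.sum_integral_adjacent_intervals
      (fun l _ ↦ hf.intervalIntegrable _ _), gridNode_zero]
  rw [hsum, Finset.mul_sum, ← Finset.sum_sub_distrib]
  calc _ ≤ ∑ l ∈ Finset.range k, ε / (T - t) * gridMesh t T n :=
        (Finset.abs_sum_le_sum_abs _ _).trans (Finset.sum_le_sum fun l hl ↦
          key l ((Finset.mem_range.1 hl).trans_le hk))
    _ = k * (ε / (T - t) * gridMesh t T n) := by simp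
    _ ≤ ((n : ℝ) + 1) * (ε / (T - t) * gridMesh t T n) := by
        have : (k : ℝ) ≤ (n : ℝ) + 1 := by exact_mod_cast hk
        gcongr
    _ = ε := by
        rw [mul_left_comm, card_mul_gridMesh]; field_simp

theorem tendsto_riemann_sum {t T : ℝ} (htT : t < T) {f : ℝ → ℝ} (hf : Continuous f) :
    Tendsto (fun n ↦ gridMesh t T n * ∑ l ∈ Finset.range (n + 1), f (gridNode t T n l)) atTop
      (𝓝 (∫ x in t..T, f x)) := by
  refine Metric.tendsto_atTop'.2 fun ε hε ↦ ?_
  obtain ⟨N, hN⟩ := eventually_atTop.1 (eventually_riemann_sum_close htT hf (half_pos hε))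
  refine ⟨N, fun n hn ↦ ?_⟩
  have := hN n hn.le (n + 1) le_rfl
  rw [gridNode_last] at this
  rw [Real.dist_eq]
  linarith

/-- Riemann sums of an iterated integral over the triangle `x < s`. -/
theorem tendsto_iterated_riemann_sum {t T : ℝ} (htT : t < T) {f g : ℝ → ℝ} (hf : Continuous f)
    (hg : Continuous g) :
    Tendsto (fun n ↦ gridMesh t T n ^ 2 * ∑ k ∈ Finset.range (n + 1),
      ∑ l ∈ Finset.range k, f (gridNode t T n l) * g (gridNode t T n k)) atTop
      (𝓝 (∫ s in t..T, g s * ∫ x in t..s, f x)) := by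
  have hF : Continuous fun s ↦ ∫ x in t..s, f x :=
    intervalIntegral.continuous_primitive (fun a b ↦ hf.intervalIntegrable a b) t
  have h1 := tendsto_riemann_sum htT (hg.mul hF)
  obtain ⟨M, hM⟩ := (isCompact_Icc (a := t) (b := T)).exists_bound_of_continuousOn hg.continuousOn
  have hM0 : 0 ≤ M := (norm_nonneg _).trans (hM t ⟨le_rfl, htT.le⟩)
  have hh : 0 < T - t := by linarith
  -- the inner Riemann sums are uniformly close to the inner integrals
  have h2 : Tendsto (fun n ↦ (gridMesh t T n ^ 2 * ∑ k ∈ Finset.range (n + 1),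
      ∑ l ∈ Finset.range k, f (gridNode t T n l) * g (gridNode t T n k)) -
      gridMesh t T n * ∑ k ∈ Finset.range (n + 1),
        g (gridNode t T n k) * ∫ x in t..gridNode t T n k, f x) atTop (𝓝 0) := by
    rw [Metric.tendsto_nhds]
    intro ε hε
    have hpos : 0 < (M + 1) * (T - t) := by positivity
    filter_upwards [eventually_riemann_sum_close htT hf (half_pos (div_pos hε hpos))] with n hn
    have hδ := gridMesh_pos htT n
    rw [dist_zero_right, Real.norm_eq_abs]
    have e : (gridMesh t T n ^ 2 * ∑ k ∈ Finset.range (n + 1),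
        ∑ l ∈ Finset.range k, f (gridNode t T n l) * g (gridNode t T n k)) -
        gridMesh t T n * ∑ k ∈ Finset.range (n + 1),
          g (gridNode t T n k) * ∫ x in t..gridNode t T n k, f x =
        gridMesh t T n * ∑ k ∈ Finset.range (n + 1), g (gridNode t T n k) *
          (gridMesh t T n * ∑ l ∈ Finset.range k, f (gridNode t T n l) -
            ∫ x in t..gridNode t T n k, f x) := by
      rw [pow_two, mul_assoc, ← mul_sub, Finset.mul_sum, ← Finset.sum_sub_distrib]
      congr 1
      refine Finset.sum_congr rfl fun k _ ↦ ?_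
      rw [← Finset.sum_mul]; ring
    rw [e, abs_mul, abs_of_pos hδ]
    calc _ ≤ gridMesh t T n * ∑ k ∈ Finset.range (n + 1),
          (M + 1) * (ε / ((M + 1) * (T - t)) / 2) := by
          refine mul_le_mul_of_nonneg_left ((Finset.abs_sum_le_sum_abs _ _).trans
            (Finset.sum_le_sum fun k hk ↦ ?_)) hδ.le
          have hk' := Finset.mem_range.1 hk
          rw [abs_mul]
          have := hM _ (gridNode_mem htT (n := n) hk'.le)
          rw [Real.norm_eq_abs] at this
          exact mul_le_mul (this.trans (by linarith)) (hn k hk'.le) (abs_nonneg _) (by linarith)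
      _ = (((n : ℝ) + 1) * gridMesh t T n) * ((M + 1) * (ε / ((M + 1) * (T - t)) / 2)) := by
          simp; ring
      _ = ε / 2 := by rw [card_mul_gridMesh]; field_simp
      _ < ε := by linarith
  simpa using h2.add h1

/-! ### The Itô isometry, and uniqueness and existence of Itô integrals -/

section

section L2

variable {α β : Type*} {mα : MeasurableSpace α} {mβ : MeasurableSpace β}

theorem MeasureTheory.MemLp.eLpNorm_two_eq_ofReal {μ : Measure α} {f : α → ℝ}
    (hf : MemLp f 2 μ) : eLpNorm f 2 μ = ENNReal.ofReal √(∫ x, f x ^ 2 ∂μ) := by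
  rw [hf.eLpNorm_eq_integral_rpow_norm (by norm_num) (by norm_num), Real.sqrt_eq_rpow]
  simp

theorem ProbabilityTheory.IndepFun.memLp_two_mul {μ : Measure α} [IsProbabilityMeasure μ]
    {f g : α → ℝ} (h : IndepFun f g μ) (hf : MemLp f 2 μ) (hg : MemLp g 2 μ) :
    MemLp (fun x ↦ f x * g x) 2 μ := by
  refine (memLp_two_iff_integrable_sq (hf.1.mul hg.1)).2 ?_
  have h2 : IndepFun (fun x ↦ f x ^ 2) (fun x ↦ g x ^ 2) μ :=
    h.comp (measurable_id.pow_const 2) (measurable_id.pow_const 2)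
  have := h2.integrable_mul hf.integrable_sq hg.integrable_sq
  refine this.congr (Eventually.of_forall fun x ↦ ?_)
  simp [mul_pow]

theorem MeasureTheory.MemLp.integrable_fun_mul {μ : Measure α} {f g : α → ℝ}
    (hf : MemLp f 2 μ) (hg : MemLp g 2 μ) : Integrable (fun x ↦ f x * g x) μ :=
  hf.integrable_mul hg

theorem integral_sub_sq_eq {μ : Measure α} {f g : α → ℝ} (hf : MemLp f 2 μ) (hg : MemLp g 2 μ) :
    ∫ x, (f x - g x) ^ 2 ∂μ =
      ∫ x, f x * f x ∂μ - 2 * ∫ x, f x * g x ∂μ + ∫ x, g x * g x ∂μ := by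
  have A := hf.integrable_fun_mul hf
  have B := (hf.integrable_fun_mul hg).const_mul 2
  have AB : Integrable (fun x ↦ f x * f x - 2 * (f x * g x)) μ := A.sub B
  rw [← integral_const_mul, ← integral_sub A B, ← integral_add AB (hg.integrable_fun_mul hg)]
  congr 1 with x
  ring

theorem eLpNorm_sub_le_of_sub {μ : Measure α} {f g h : α → ℝ} (hf : AEStronglyMeasurable f μ)
    (hg : AEStronglyMeasurable g μ) (hh : AEStronglyMeasurable h μ) :
    eLpNorm (fun x ↦ f x - g x) 2 μ ≤
      eLpNorm (fun x ↦ f x - h x) 2 μ + eLpNorm (fun x ↦ g x - h x) 2 μ := by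
  have e : (fun x ↦ f x - g x) = (fun x ↦ f x - h x) - fun x ↦ g x - h x := by
    ext x; simp
  rw [e]
  exact eLpNorm_sub_le (hf.sub hh) (hg.sub hh) (by norm_num)

/-- A Cauchy criterion: an `L²` sequence whose increments are dominated in norm by those of a
convergent sequence (possibly on another space) converges in `L²`. -/
theorem exists_tendsto_eLpNorm_of_eLpNorm_sub_le {μ : Measure α} {ν : Measure β}
    {X : ℕ → α → ℝ} {Y : ℕ → β → ℝ} {H : β → ℝ} (hX : ∀ n, MemLp (X n) 2 μ)
    (hY : ∀ n, AEStronglyMeasurable (Y n) ν) (hH : AEStronglyMeasurable H ν)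
    (hle : ∀ n k, eLpNorm (fun x ↦ X n x - X k x) 2 μ ≤ eLpNorm (fun y ↦ Y n y - Y k y) 2 ν)
    (hlim : Tendsto (fun n ↦ eLpNorm (fun y ↦ Y n y - H y) 2 ν) atTop (𝓝 0)) :
    ∃ Z, MemLp Z 2 μ ∧ Tendsto (fun n ↦ eLpNorm (fun x ↦ X n x - Z x) 2 μ) atTop (𝓝 0) := by
  have hc : CauchySeq fun n ↦ (hX n).toLp (X n) := by
    rw [EMetric.cauchySeq_iff]
    intro ε hε
    have h2 : 0 < ε / 2 := ENNReal.half_pos hε.ne'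
    obtain ⟨N, hN⟩ := eventually_atTop.1 (hlim.eventually_lt_const h2)
    refine ⟨N, fun n hn k hk ↦ ?_⟩
    rw [Lp.edist_toLp_toLp]
    calc _ ≤ eLpNorm (fun y ↦ Y n y - Y k y) 2 ν := hle n k
      _ ≤ _ := eLpNorm_sub_le_of_sub (hY n) (hY k) hH
      _ < ε / 2 + ε / 2 := ENNReal.add_lt_add (hN n hn) (hN k hk)
      _ = ε := ENNReal.add_halves ε
  obtain ⟨Z, hZ⟩ := cauchySeq_tendsto_of_complete hc
  refine ⟨Z, Lp.memLp Z, ?_⟩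
  rw [Lp.tendsto_Lp_iff_tendsto_eLpNorm'] at hZ
  refine hZ.congr fun n ↦ eLpNorm_congr_ae ?_
  filter_upwards [(hX n).coeFn_toLp] with x hx
  simp [hx]

end L2

variable {Ω : Type*} {mΩ : MeasurableSpace Ω} {P : Measure Ω}
  {𝓕 : Filtration ℝ mΩ} {m : ℕ} {W : Fin m → ℝ → Ω → ℝ} {S : ℝ}

namespace IsWienerProcess

theorem measurable (hW : IsWienerProcess W 𝓕 S P) (i : Fin m) {s : ℝ} (hs : s ∈ Set.Icc 0 S) :
    Measurable (W i s) := (hW.adapted i s hs).mono (𝓕.le s) le_rfl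

theorem hasLaw_sub (hW : IsWienerProcess W 𝓕 S P) (i : Fin m) {s u : ℝ} (hs : 0 ≤ s)
    (hsu : s ≤ u) (hu : u ≤ S) :
    HasLaw (fun ω ↦ W i u ω - W i s ω) (gaussianReal 0 (u - s).toNNReal) P :=
  (measurePreserving_eval (fun _ : Fin m ↦ gaussianReal 0 (u - s).toNNReal) i).fun_comp_hasLaw
    (hW.law_increment s u hs hsu hu)

theorem indepFun_past (hW : IsWienerProcess W 𝓕 S P) (i : Fin m) {s u : ℝ} (hs : 0 ≤ s)
    (hsu : s ≤ u) (hu : u ≤ S) {c : Ω → ℝ} (hc : Measurable[𝓕 s] c) :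
    IndepFun c (fun ω ↦ W i u ω - W i s ω) P := by
  have h := indep_of_indep_of_le_right (hW.indep_increment s u hs hsu hu) hc.comap_le
  refine (indep_of_indep_of_le_left h (m₃ := MeasurableSpace.comap
    (fun ω ↦ W i u ω - W i s ω) inferInstance) ?_).symm
  exact MeasurableSpace.comap_le_iff_le_map.2 fun A hA ↦
    ⟨(fun x : Fin m → ℝ ↦ x i) ⁻¹' A, measurable_pi_apply i hA, rfl⟩

theorem memLp_sub (hW : IsWienerProcess W 𝓕 S P) (i : Fin m) {s u : ℝ} (hs : 0 ≤ s)
    (hsu : s ≤ u) (hu : u ≤ S) : MemLp (fun ω ↦ W i u ω - W i s ω) 2 P := by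
  have h := hW.hasLaw_sub i hs hsu hu
  have h2 : MemLp id 2 (P.map fun ω ↦ W i u ω - W i s ω) := by
    rw [h.map_eq]; exact memLp_id_gaussianReal' 2 (by norm_num)
  exact (memLp_map_measure_iff (by fun_prop) h.aemeasurable).1 h2

theorem integral_sub (hW : IsWienerProcess W 𝓕 S P) (i : Fin m) {s u : ℝ} (hs : 0 ≤ s)
    (hsu : s ≤ u) (hu : u ≤ S) : ∫ ω, (W i u ω - W i s ω) ∂P = 0 := by
  rw [(hW.hasLaw_sub i hs hsu hu).integral_eq, integral_id_gaussianReal]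

theorem integral_sub_sq (hW : IsWienerProcess W 𝓕 S P) (i : Fin m) {s u : ℝ} (hs : 0 ≤ s)
    (hsu : s ≤ u) (hu : u ≤ S) : ∫ ω, (W i u ω - W i s ω) ^ 2 ∂P = u - s := by
  have h := hW.hasLaw_sub i hs hsu hu
  have h2 := h.variance_eq
  rw [variance_id_gaussianReal, variance_of_integral_eq_zero h.aemeasurable
    (hW.integral_sub i hs hsu hu), Real.coe_toNNReal _ (by linarith)] at h2
  exact h2

/-- Products of an increment and a square integrable random variable from its past. -/
theorem memLp_mul_sub [IsProbabilityMeasure P]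
    (hW : IsWienerProcess W 𝓕 S P) (i : Fin m) {s u : ℝ} (hs : 0 ≤ s)
    (hsu : s ≤ u) (hu : u ≤ S) {c : Ω → ℝ} (hc : Measurable[𝓕 s] c) (hc2 : MemLp c 2 P) :
    MemLp (fun ω ↦ c ω * (W i u ω - W i s ω)) 2 P :=
  (hW.indepFun_past i hs hsu hu hc).memLp_two_mul hc2 (hW.memLp_sub i hs hsu hu)

theorem measurable_mul_sub (hW : IsWienerProcess W 𝓕 S P) (i : Fin m) {s u v : ℝ} (hs : 0 ≤ s)
    (hsu : s ≤ u) (huv : u ≤ v) (hv : v ≤ S) {c : Ω → ℝ} (hc : Measurable[𝓕 s] c) :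
    Measurable[𝓕 v] (fun ω ↦ c ω * (W i u ω - W i s ω)) := by
  have h1 := hc.mono (𝓕.mono (hsu.trans huv)) le_rfl
  have h2 := (hW.adapted i u ⟨hs.trans hsu, huv.trans hv⟩).mono (𝓕.mono huv) le_rfl
  have h3 := (hW.adapted i s ⟨hs, hsu.trans (huv.trans hv)⟩).mono
    (𝓕.mono (hsu.trans huv)) le_rfl
  exact h1.mul (h2.sub h3)

/-- Increments over consecutive intervals, weighted with variables from their pasts, are
orthogonal. -/
theorem integral_mul_of_le (hW : IsWienerProcess W 𝓕 S P) (i : Fin m) {a b a' b' : ℝ}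
    (ha : 0 ≤ a) (hab : a ≤ b) (hba : b ≤ a') (hab' : a' ≤ b') (hb' : b' ≤ S) {c c' : Ω → ℝ}
    (hc : Measurable[𝓕 a] c) (hc' : Measurable[𝓕 a'] c') :
    ∫ ω, (c ω * (W i b ω - W i a ω)) * (c' ω * (W i b' ω - W i a' ω)) ∂P = 0 := by
  have h0 := hW.measurable_mul_sub i ha hab hba (hab'.trans hb') hc
  have h1 : Measurable[𝓕 a'] (fun ω ↦ (c ω * (W i b ω - W i a ω)) * c' ω) := h0.mul hc'
  have ha' := ha.trans (hab.trans hba)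
  have h2 := (hW.indepFun_past i ha' hab' hb' h1).integral_fun_mul_eq_mul_integral
    (h1.mono (𝓕.le a') le_rfl).aestronglyMeasurable (hW.memLp_sub i ha' hab' hb').1
  rw [hW.integral_sub i ha' hab' hb', mul_zero] at h2
  simpa only [mul_assoc] using h2

theorem integral_mul_self (hW : IsWienerProcess W 𝓕 S P) (i : Fin m) {a b : ℝ}
    (ha : 0 ≤ a) (hab : a ≤ b) (hb : b ≤ S) {c c' : Ω → ℝ}
    (hc : Measurable[𝓕 a] c) (hc' : Measurable[𝓕 a] c') :
    ∫ ω, (c ω * (W i b ω - W i a ω)) * (c' ω * (W i b ω - W i a ω)) ∂P =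
      (∫ ω, c ω * c' ω ∂P) * (b - a) := by
  have h1 : Measurable[𝓕 a] (fun ω ↦ c ω * c' ω) := hc.mul hc'
  have h2 : IndepFun (fun ω ↦ c ω * c' ω) (fun ω ↦ (W i b ω - W i a ω) ^ 2) P :=
    (hW.indepFun_past i ha hab hb h1).comp measurable_id (measurable_id.pow_const 2)
  have h3 := h2.integral_fun_mul_eq_mul_integral
    (h1.mono (𝓕.le a) le_rfl).aestronglyMeasurable ((hW.memLp_sub i ha hab hb).1.pow 2)
  rw [hW.integral_sub_sq i ha hab hb] at h3
  rw [← h3]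
  congr 1 with ω
  ring

/-- The Itô isometry for two one-step processes, the second of which starts later. -/
theorem integral_mul_of_left_le [IsProbabilityMeasure P]
    (hW : IsWienerProcess W 𝓕 S P) (i : Fin m) {a b a' b' : ℝ}
    (ha : 0 ≤ a) (hab : a ≤ b) (haa : a ≤ a') (hab' : a' ≤ b') (hb : b ≤ S) (hb' : b' ≤ S)
    {c c' : Ω → ℝ} (hc : Measurable[𝓕 a] c) (hc' : Measurable[𝓕 a'] c')
    (hc2 : MemLp c 2 P) (hc2' : MemLp c' 2 P) :
    ∫ ω, (c ω * (W i b ω - W i a ω)) * (c' ω * (W i b' ω - W i a' ω)) ∂P =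
      (∫ ω, c ω * c' ω ∂P) * max 0 (min b b' - max a a') := by
  rcases le_total b a' with hba | hba
  · rw [hW.integral_mul_of_le i ha hab hba hab' hb' hc hc', max_eq_left, mul_zero]
    linarith [min_le_left b b', le_max_right a a']
  have hcm : Measurable[𝓕 a'] c := hc.mono (𝓕.mono haa) le_rfl
  have ha' := ha.trans haa
  obtain ⟨q, hq⟩ : ∃ q, q = min b b' := ⟨_, rfl⟩
  have hqa : a' ≤ q := hq ▸ le_min hba hab'
  have hqb : q ≤ b := hq ▸ min_le_left _ _
  have hqb' : q ≤ b' := hq ▸ min_le_right _ _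
  rw [← hq, max_eq_right haa, max_eq_right (by linarith)]
  have hcq : Measurable[𝓕 q] c := hcm.mono (𝓕.mono hqa) le_rfl
  have hcq' : Measurable[𝓕 q] c' := hc'.mono (𝓕.mono hqa) le_rfl
  -- split both intervals at the endpoints of their intersection `(a', q]`
  have M1 := hW.memLp_mul_sub i ha haa (hqa.trans (hqb.trans hb)) hc hc2
  have M2 := hW.memLp_mul_sub i ha' hqa (hqb.trans hb) hcm hc2
  have M3 := hW.memLp_mul_sub i (ha'.trans hqa) hqb hb hcq hc2
  have N2 := hW.memLp_mul_sub i ha' hqa (hqb.trans hb) hc' hc2'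
  have N3 := hW.memLp_mul_sub i (ha'.trans hqa) hqb' hb' hcq' hc2'
  have e12 := hW.integral_mul_of_le i ha haa le_rfl hqa (hqb.trans hb) hc hc'
  have e13 := hW.integral_mul_of_le i ha haa hqa hqb' hb' hc hcq'
  have e22 := hW.integral_mul_self i ha' hqa (hqb.trans hb) hcm hc'
  have e23 := hW.integral_mul_of_le i ha' hqa le_rfl hqb' hb' hcm hcq'
  have e32 := hW.integral_mul_of_le i ha' hqa le_rfl hqb hb hc' hcq
  have e33 : ∫ ω, (c ω * (W i b ω - W i q ω)) * (c' ω * (W i b' ω - W i q ω)) ∂P = 0 := by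
    rcases min_choice b b' with h | h <;> rw [← hq] at h <;> simp [h]
  have I12 := M1.integrable_fun_mul N2
  have I13 := M1.integrable_fun_mul N3
  have I22 := M2.integrable_fun_mul N2
  have I23 := M2.integrable_fun_mul N3
  have I32 := N2.integrable_fun_mul M3
  have I33 := M3.integrable_fun_mul N3
  have key := integral_add (((((I12.add I13).add I22).add I23).add I32)) I33
  rw [integral_add' (((I12.add I13).add I22).add I23) I32,
    integral_add' ((I12.add I13).add I22) I23, integral_add' (I12.add I13) I22,
    integral_add' I12 I13] at key
  simp only [Pi.add_apply] at key
  rw [e12, e13, e22, e23, e32, e33] at key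
  simp only [zero_add, add_zero] at key
  rw [← key]
  congr 1 with ω
  ring

/-- The Itô isometry for two one-step processes. -/
theorem integral_mul_step [IsProbabilityMeasure P]
    (hW : IsWienerProcess W 𝓕 S P) (i : Fin m) {a b a' b' : ℝ}
    (ha : 0 ≤ a) (hab : a ≤ b) (ha' : 0 ≤ a') (hab' : a' ≤ b') (hb : b ≤ S) (hb' : b' ≤ S)
    {c c' : Ω → ℝ} (hc : Measurable[𝓕 a] c) (hc' : Measurable[𝓕 a'] c')
    (hc2 : MemLp c 2 P) (hc2' : MemLp c' 2 P) :
    ∫ ω, (c ω * (W i b ω - W i a ω)) * (c' ω * (W i b' ω - W i a' ω)) ∂P =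
      (∫ ω, c ω * c' ω ∂P) * max 0 (min b b' - max a a') := by
  rcases le_total a a' with h | h
  · exact hW.integral_mul_of_left_le i ha hab h hab' hb hb' hc hc' hc2 hc2'
  · have := hW.integral_mul_of_left_le i ha' hab' h hab hb' hb hc' hc hc2' hc2
    rw [min_comm b, max_comm a]
    simp only [mul_comm (c _) (c' _)]
    rw [← this]
    congr 1 with ω
    ring

end IsWienerProcess

namespace SimpleItoProcess

variable {a b : ℝ}

theorem node_mem (V : SimpleItoProcess 𝓕 P a b) {k : ℕ} (hk : k ≤ V.n) :
    V.node k ∈ Set.Icc a b :=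
  ⟨V.node_first.symm.trans_le (V.node_mono (Nat.zero_le k)),
    (V.node_mono hk).trans_eq V.node_last⟩

theorem memLp_integral [IsProbabilityMeasure P]
    (hW : IsWienerProcess W 𝓕 S P) (i : Fin m) (ha : 0 ≤ a) (hb : b ≤ S)
    (V : SimpleItoProcess 𝓕 P a b) : MemLp (V.integral (W i)) 2 P := by
  refine memLp_finsetSum _ fun k hk ↦ ?_
  have hk := Finset.mem_range.1 hk
  exact hW.memLp_mul_sub i (ha.trans (V.node_mem hk.le).1) (V.node_mono (Nat.le_succ k))
    ((V.node_mem (k := k + 1) hk).2.trans hb) (V.coeff_measurable k hk) (V.coeff_memLp k hk)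

theorem memLp_step [IsProbabilityMeasure P] (V : SimpleItoProcess 𝓕 P a b) {k : ℕ} (hk : k < V.n) :
    MemLp (fun p : ℝ × Ω ↦ (Set.Ioc (V.node k) (V.node (k + 1))).indicator
      (fun _ ↦ V.coeff k p.2) p.1) 2 ((volume.restrict (Set.Ioc a b)).prod P) := by
  have h : MemLp (fun p : ℝ × Ω ↦ V.coeff k p.2) 2 ((volume.restrict (Set.Ioc a b)).prod P) := by
    have := (V.coeff_memLp k hk).comp_snd (volume.restrict (Set.Ioc a b))
    exact this
  have h2 := h.indicator (s := Prod.fst ⁻¹' Set.Ioc (V.node k) (V.node (k + 1)))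
    (measurable_fst measurableSet_Ioc)
  refine (memLp_congr_ae (Eventually.of_forall fun p ↦ ?_)).1 h2
  simp [Set.indicator]

theorem memLp_val [IsProbabilityMeasure P] (V : SimpleItoProcess 𝓕 P a b) :
    MemLp (fun p : ℝ × Ω ↦ V.val p.1 p.2) 2 ((volume.restrict (Set.Ioc a b)).prod P) :=
  memLp_finsetSum _ fun _ hk ↦ V.memLp_step (Finset.mem_range.1 hk)

/-- The inner product of two steps is the mean of the product of the coefficients, times the length
of the intersection of the intervals. -/
theorem integral_step_mul_step [IsProbabilityMeasure P] (V V' : SimpleItoProcess 𝓕 P a b)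
    {k : ℕ} (hk : k < V.n) (l : ℕ) :
    ∫ p : ℝ × Ω, (Set.Ioc (V.node k) (V.node (k + 1))).indicator (fun _ ↦ V.coeff k p.2) p.1 *
      (Set.Ioc (V'.node l) (V'.node (l + 1))).indicator (fun _ ↦ V'.coeff l p.2) p.1
        ∂((volume.restrict (Set.Ioc a b)).prod P) =
    (∫ ω, V.coeff k ω * V'.coeff l ω ∂P) *
      max 0 (min (V.node (k + 1)) (V'.node (l + 1)) - max (V.node k) (V'.node l)) := by
  have e : ∀ p : ℝ × Ω,
      (Set.Ioc (V.node k) (V.node (k + 1))).indicator (fun _ ↦ V.coeff k p.2) p.1 *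
      (Set.Ioc (V'.node l) (V'.node (l + 1))).indicator (fun _ ↦ V'.coeff l p.2) p.1 =
      (Set.Ioc (max (V.node k) (V'.node l)) (min (V.node (k + 1)) (V'.node (l + 1)))).indicator
        (fun _ ↦ (1 : ℝ)) p.1 * (V.coeff k p.2 * V'.coeff l p.2) := by
    intro p
    rw [← Set.Ioc_inter_Ioc]
    by_cases h1 : p.1 ∈ Set.Ioc (V.node k) (V.node (k + 1)) <;>
    by_cases h2 : p.1 ∈ Set.Ioc (V'.node l) (V'.node (l + 1)) <;>
    simp [Set.indicator, h1, h2, -Set.mem_Ioc]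
  simp only [e]
  rw [integral_prod_mul (fun s ↦ (Set.Ioc (max (V.node k) (V'.node l))
    (min (V.node (k + 1)) (V'.node (l + 1)))).indicator (fun _ ↦ (1 : ℝ)) s)
    (fun ω ↦ V.coeff k ω * V'.coeff l ω), mul_comm]
  congr 1
  rw [integral_indicator_const _ measurableSet_Ioc, measureReal_restrict_apply measurableSet_Ioc,
    Set.inter_eq_left.2, Real.volume_real_Ioc, max_comm, smul_eq_mul, mul_one]
  refine Set.Ioc_subset_Ioc ?_ ?_
  · exact (V.node_mem hk.le).1.trans (le_max_left _ _)
  · exact (min_le_left _ _).trans (V.node_mem (k := k + 1) hk).2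

/-- The Itô isometry for simple processes, in polarized form. -/
theorem integral_integral_mul_integral [IsProbabilityMeasure P]
    (hW : IsWienerProcess W 𝓕 S P) (i : Fin m) (ha : 0 ≤ a)
    (hb : b ≤ S) (V V' : SimpleItoProcess 𝓕 P a b) :
    ∫ ω, V.integral (W i) ω * V'.integral (W i) ω ∂P =
      ∫ p : ℝ × Ω, V.val p.1 p.2 * V'.val p.1 p.2 ∂((volume.restrict (Set.Ioc a b)).prod P) := by
  have hm : ∀ (U : SimpleItoProcess 𝓕 P a b) {k : ℕ}, k < U.n → 0 ≤ U.node k ∧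
      U.node k ≤ U.node (k + 1) ∧ U.node (k + 1) ≤ S := fun U k hk ↦
    ⟨ha.trans (U.node_mem hk.le).1, U.node_mono (Nat.le_succ k),
      (U.node_mem (k := k + 1) hk).2.trans hb⟩
  have hI : ∀ (U : SimpleItoProcess 𝓕 P a b) {k : ℕ}, k < U.n →
      MemLp (fun ω ↦ U.coeff k ω * (W i (U.node (k + 1)) ω - W i (U.node k) ω)) 2 P :=
    fun U k hk ↦ hW.memLp_mul_sub i (hm U hk).1 (hm U hk).2.1 (hm U hk).2.2
      (U.coeff_measurable k hk) (U.coeff_memLp k hk)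
  simp only [SimpleItoProcess.integral, SimpleItoProcess.val, Finset.sum_mul_sum]
  rw [integral_finsetSum _ fun k hk ↦ integrable_finsetSum _ fun l hl ↦
      (hI V (Finset.mem_range.1 hk)).integrable_fun_mul (hI V' (Finset.mem_range.1 hl)),
    integral_finsetSum _ fun k hk ↦ integrable_finsetSum _ fun l hl ↦
      (V.memLp_step (Finset.mem_range.1 hk)).integrable_fun_mul
        (V'.memLp_step (Finset.mem_range.1 hl))]
  refine Finset.sum_congr rfl fun k hk ↦ ?_
  have hk' := Finset.mem_range.1 hk
  rw [integral_finsetSum _ fun l hl ↦ (hI V hk').integrable_fun_mul (hI V' (Finset.mem_range.1 hl)),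
    integral_finsetSum _ fun l hl ↦
      (V.memLp_step hk').integrable_fun_mul (V'.memLp_step (Finset.mem_range.1 hl))]
  refine Finset.sum_congr rfl fun l hl ↦ ?_
  have hl' := Finset.mem_range.1 hl
  rw [V.integral_step_mul_step V' hk' l, hW.integral_mul_step i (hm V hk').1 (hm V hk').2.1
    (hm V' hl').1 (hm V' hl').2.1 (hm V hk').2.2 (hm V' hl').2.2 (V.coeff_measurable k hk')
    (V'.coeff_measurable l hl') (V.coeff_memLp k hk') (V'.coeff_memLp l hl')]

/-- The Itô isometry for the difference of two simple processes. -/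
theorem eLpNorm_integral_sub [IsProbabilityMeasure P]
    (hW : IsWienerProcess W 𝓕 S P) (i : Fin m) (ha : 0 ≤ a)
    (hb : b ≤ S) (V V' : SimpleItoProcess 𝓕 P a b) :
    eLpNorm (fun ω ↦ V.integral (W i) ω - V'.integral (W i) ω) 2 P =
      eLpNorm (fun p : ℝ × Ω ↦ V.val p.1 p.2 - V'.val p.1 p.2) 2
        ((volume.restrict (Set.Ioc a b)).prod P) := by
  have M := memLp_integral hW i ha hb V
  have M' := memLp_integral hW i ha hb V'
  have N := V.memLp_val
  have N' := V'.memLp_val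
  have h1 := (M.sub M').eLpNorm_two_eq_ofReal
  have h2 := (N.sub N').eLpNorm_two_eq_ofReal
  simp only [Pi.sub_apply] at h1 h2
  rw [integral_sub_sq_eq M M', integral_integral_mul_integral hW i ha hb,
    integral_integral_mul_integral hW i ha hb, integral_integral_mul_integral hW i ha hb] at h1
  rw [integral_sub_sq_eq N N'] at h2
  exact h1.trans h2.symm

end SimpleItoProcess

section ItoIntegral

variable {a b : ℝ} {H : ℝ → Ω → ℝ}

/-- The Itô integral is the limit of the integrals of *every* approximating sequence of simple
processes. -/
theorem IsItoIntegral.tendsto [IsProbabilityMeasure P]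
    (hW : IsWienerProcess W 𝓕 S P) (i : Fin m) (ha : 0 ≤ a)
    (hb : b ≤ S) {X : Ω → ℝ} (hX : IsItoIntegral 𝓕 P (W i) a b H X)
    (hH : AEStronglyMeasurable (fun p : ℝ × Ω ↦ H p.1 p.2)
      ((volume.restrict (Set.Ioc a b)).prod P))
    {V : ℕ → SimpleItoProcess 𝓕 P a b}
    (hV : Tendsto (fun n ↦ eLpNorm (fun p : ℝ × Ω ↦ (V n).val p.1 p.2 - H p.1 p.2) 2
      ((volume.restrict (Set.Ioc a b)).prod P)) atTop (𝓝 0)) :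
    Tendsto (fun n ↦ eLpNorm (fun ω ↦ (V n).integral (W i) ω - X ω) 2 P) atTop (𝓝 0) := by
  obtain ⟨hX2, U, hU, hUX⟩ := hX
  refine tendsto_of_tendsto_of_tendsto_of_le_of_le tendsto_const_nhds
    (by simpa using (hV.add hU).add hUX) (fun _ ↦ zero_le) fun n ↦ ?_
  have MV := SimpleItoProcess.memLp_integral hW i ha hb (V n)
  have MU := SimpleItoProcess.memLp_integral hW i ha hb (U n)
  calc _ = eLpNorm ((fun ω ↦ (V n).integral (W i) ω - (U n).integral (W i) ω) +
        fun ω ↦ (U n).integral (W i) ω - X ω) 2 P := by congr 1; ext ω; simp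
    _ ≤ _ := eLpNorm_add_le (MV.1.sub MU.1) (MU.1.sub hX2.1) (by norm_num)
    _ ≤ _ := by
      rw [SimpleItoProcess.eLpNorm_integral_sub hW i ha hb]
      gcongr
      exact eLpNorm_sub_le_of_sub (V n).memLp_val.1 (U n).memLp_val.1 hH

theorem exists_isItoIntegral [IsProbabilityMeasure P]
    (hW : IsWienerProcess W 𝓕 S P) (i : Fin m) (ha : 0 ≤ a)
    (hb : b ≤ S) (hH : AEStronglyMeasurable (fun p : ℝ × Ω ↦ H p.1 p.2)
      ((volume.restrict (Set.Ioc a b)).prod P))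
    {V : ℕ → SimpleItoProcess 𝓕 P a b}
    (hV : Tendsto (fun n ↦ eLpNorm (fun p : ℝ × Ω ↦ (V n).val p.1 p.2 - H p.1 p.2) 2
      ((volume.restrict (Set.Ioc a b)).prod P)) atTop (𝓝 0)) :
    ∃ X, IsItoIntegral 𝓕 P (W i) a b H X := by
  obtain ⟨Z, hZ, hlim⟩ := exists_tendsto_eLpNorm_of_eLpNorm_sub_le
    (fun n ↦ SimpleItoProcess.memLp_integral hW i ha hb (V n)) (fun n ↦ (V n).memLp_val.1) hH
    (fun n k ↦ (SimpleItoProcess.eLpNorm_integral_sub hW i ha hb (V n) (V k)).le) hV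
  exact ⟨Z, hZ, V, hV, hlim⟩

theorem isItoIntegral_itoIntegral {w : ℝ → Ω → ℝ} (h : ∃ X, IsItoIntegral 𝓕 P w a b H X) :
    IsItoIntegral 𝓕 P w a b H (itoIntegral 𝓕 P w a b H) := by
  rw [itoIntegral, dif_pos h]
  exact h.choose_spec

theorem isIteratedItoIntegral_iteratedItoIntegral {v w : ℝ → Ω → ℝ}
    (h : ∃ X, IsIteratedItoIntegral 𝓕 P v w a b X) :
    IsIteratedItoIntegral 𝓕 P v w a b (iteratedItoIntegral 𝓕 P v w a b) := by
  rw [iteratedItoIntegral, dif_pos h]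
  exact h.choose_spec

theorem ae_eq_of_tendsto_eLpNorm {α : Type*} {mα : MeasurableSpace α} {μ : Measure α}
    {X : ℕ → α → ℝ} {Y Z : α → ℝ} (hX : ∀ n, AEStronglyMeasurable (X n) μ)
    (hYm : AEStronglyMeasurable Y μ) (hZm : AEStronglyMeasurable Z μ)
    (hY : Tendsto (fun n ↦ eLpNorm (fun x ↦ X n x - Y x) 2 μ) atTop (𝓝 0))
    (hZ : Tendsto (fun n ↦ eLpNorm (fun x ↦ X n x - Z x) 2 μ) atTop (𝓝 0)) : Y =ᵐ[μ] Z := by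
  have h0 : eLpNorm (Z - Y) 2 μ = 0 := by
    refine le_antisymm (ge_of_tendsto' (by simpa using hY.add hZ) fun n ↦ ?_) zero_le
    have h := eLpNorm_sub_le_of_sub hYm hZm (hX n)
    rw [eLpNorm_sub_comm]
    refine h.trans_eq ?_
    congr 1 <;> exact eLpNorm_sub_comm _ _ _ _
  filter_upwards [(eLpNorm_eq_zero_iff (hZm.sub hYm) (by norm_num)).1 h0] with x hx
  simp only [Pi.sub_apply, Pi.zero_apply] at hx
  linarith

end ItoIntegral

end

/-! ### Approximation of Itô integrals by Riemann sums -/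

section

/-- An `L²` bound on almost all sections bounds the `L²` norm on the product. -/
theorem eLpNorm_two_prod_le {α β : Type*} {mα : MeasurableSpace α} {mβ : MeasurableSpace β}
    {μ : Measure α} {ν : Measure β} [SFinite ν] {f : α × β → ℝ}
    (hf : AEStronglyMeasurable f (μ.prod ν)) {C : ENNReal}
    (hC : ∀ᵐ x ∂μ, eLpNorm (fun y ↦ f (x, y)) 2 ν ≤ C) :
    eLpNorm f 2 (μ.prod ν) ≤ C * μ Set.univ ^ (1 / 2 : ℝ) := by
  have h2 : ∀ {γ : Type _} {_ : MeasurableSpace γ} (ρ : Measure γ) (g : γ → ℝ),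
      eLpNorm g 2 ρ = (∫⁻ x, ‖g x‖ₑ ^ (2 : ℝ) ∂ρ) ^ (1 / 2 : ℝ) := by
    intro γ _ ρ g
    rw [eLpNorm_eq_lintegral_rpow_enorm_toReal (by norm_num) (by norm_num)]
    simp
  rw [h2, lintegral_prod _ (hf.enorm.pow_const _)]
  have h3 : ∀ᵐ x ∂μ, ∫⁻ y, ‖f (x, y)‖ₑ ^ (2 : ℝ) ∂ν ≤ C ^ (2 : ℝ) := by
    filter_upwards [hC] with x hx
    have h2' := eLpNorm_eq_lintegral_rpow_enorm_toReal (μ := ν) (f := fun y ↦ f (x, y))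
      (p := 2) (by norm_num) (by norm_num)
    rw [h2'] at hx
    simp only [ENNReal.toReal_ofNat] at hx
    calc _ = ((∫⁻ y, ‖f (x, y)‖ₑ ^ (2 : ℝ) ∂ν) ^ (1 / 2 : ℝ)) ^ (2 : ℝ) := by
          rw [← ENNReal.rpow_mul]; norm_num
      _ ≤ _ := by gcongr
  calc _ ≤ (∫⁻ _, C ^ (2 : ℝ) ∂μ) ^ (1 / 2 : ℝ) := by
        gcongr ?_ ^ _
        exact lintegral_mono_ae h3
    _ = _ := by
        rw [lintegral_const, ENNReal.mul_rpow_of_nonneg _ _ (by norm_num), ← ENNReal.rpow_mul]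
        norm_num

variable {Ω : Type*} {mΩ : MeasurableSpace Ω} {P : Measure Ω}
  {𝓕 : Filtration ℝ mΩ} {m : ℕ} {W : Fin m → ℝ → Ω → ℝ} {S : ℝ}

theorem SimpleItoProcess.exists_val_eq {a b : ℝ} (V : SimpleItoProcess 𝓕 P a b) {s : ℝ}
    (hs : s ∈ Set.Ioc a b) :
    ∃ k < V.n, s ∈ Set.Ioc (V.node k) (V.node (k + 1)) ∧ ∀ ω, V.val s ω = V.coeff k ω := by
  classical
  -- `s` lies in the interval that ends at the first node not below `s`
  have hex : ∃ k, s ≤ V.node k := ⟨V.n, by rw [V.node_last]; exact hs.2⟩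
  obtain ⟨k, hk⟩ : ∃ k, Nat.find hex = k + 1 := by
    refine Nat.exists_eq_succ_of_ne_zero fun h0 ↦ ?_
    have := Nat.find_spec hex
    rw [h0, V.node_first] at this
    exact absurd hs.1 (not_lt.2 this)
  have h1 : s ≤ V.node (k + 1) := hk ▸ Nat.find_spec hex
  have h2 : V.node k < s := not_le.1 (Nat.find_min hex (by omega))
  have h3 : k < V.n := by
    have := Nat.find_min' hex (show s ≤ V.node V.n by rw [V.node_last]; exact hs.2)
    omega
  refine ⟨k, h3, ⟨h2, h1⟩, fun ω ↦ ?_⟩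
  rw [SimpleItoProcess.val, Finset.sum_eq_single_of_mem k (Finset.mem_range.2 h3),
    Set.indicator_of_mem (Set.mem_Ioc.2 ⟨h2, h1⟩)]
  intro l _ hlk
  refine Set.indicator_of_notMem (fun hl ↦ ?_) _
  rcases lt_or_gt_of_ne hlk with h | h
  · exact absurd (hl.2.trans (V.node_mono (Nat.succ_le_of_lt h))) (not_le.2 h2)
  · exact absurd (h1.trans (V.node_mono (Nat.succ_le_of_lt h))) (not_le.2 hl.1)

/-- The simple process that samples the process `H` at the nodes of the uniform partition. -/
noncomputable def gridProcess {t T : ℝ} (htT : t < T) (H : ℝ → Ω → ℝ)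
    (hm : ∀ s ∈ Set.Icc t T, Measurable[𝓕 s] (H s)) (h2 : ∀ s ∈ Set.Icc t T, MemLp (H s) 2 P)
    (n : ℕ) : SimpleItoProcess 𝓕 P t T where
  n := n + 1
  node := gridNode t T n
  coeff k := H (gridNode t T n k)
  node_mono := gridNode_mono htT n
  node_first := gridNode_zero t T n
  node_last := gridNode_last t T n
  coeff_measurable _ hk := hm _ (gridNode_mem htT hk.le)
  coeff_memLp _ hk := h2 _ (gridNode_mem htT hk.le)

/-- The sampled processes approximate a mean square continuous process. -/
theorem tendsto_gridProcess [IsProbabilityMeasure P] {t T : ℝ} (htT : t < T) {H : ℝ → Ω → ℝ}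
    (hm : ∀ s ∈ Set.Icc t T, Measurable[𝓕 s] (H s)) (h2 : ∀ s ∈ Set.Icc t T, MemLp (H s) 2 P)
    (hH : AEStronglyMeasurable (fun p : ℝ × Ω ↦ H p.1 p.2)
      ((volume.restrict (Set.Ioc t T)).prod P)) {C : ℕ → ENNReal} (hC : Tendsto C atTop (𝓝 0))
    (hcont : ∀ᶠ n in atTop, ∀ k < n + 1,
      ∀ s ∈ Set.Icc (gridNode t T n k) (gridNode t T n (k + 1)),
        eLpNorm (fun ω ↦ H (gridNode t T n k) ω - H s ω) 2 P ≤ C n) :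
    Tendsto (fun n ↦ eLpNorm (fun p : ℝ × Ω ↦ (gridProcess htT H hm h2 n).val p.1 p.2 - H p.1 p.2)
      2 ((volume.restrict (Set.Ioc t T)).prod P)) atTop (𝓝 0) := by
  have hlim : Tendsto (fun n ↦ C n * (volume.restrict (Set.Ioc t T)) Set.univ ^ (1 / 2 : ℝ))
      atTop (𝓝 0) := by
    have := ENNReal.Tendsto.mul_const hC (b := (volume.restrict (Set.Ioc t T)) Set.univ ^
      (1 / 2 : ℝ)) (Or.inr (by simp))
    simpa using this
  refine tendsto_of_tendsto_of_tendsto_of_le_of_le' tendsto_const_nhds hlim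
    (Eventually.of_forall fun _ ↦ zero_le) ?_
  filter_upwards [hcont] with n hn
  refine eLpNorm_two_prod_le ?_ ?_
  · exact (gridProcess htT H hm h2 n).memLp_val.1.sub hH
  filter_upwards [ae_restrict_mem measurableSet_Ioc] with s hs
  obtain ⟨k, hk, hks, hval⟩ := (gridProcess htT H hm h2 n).exists_val_eq hs
  simp only [hval]
  exact hn k hk s (Set.Ioc_subset_Icc_self hks)

section Deterministic

variable [IsProbabilityMeasure P] {t T : ℝ}

/-- The step process with the values of the function `f` at the nodes of the uniform partition. -/
noncomputable def deterministicGridProcess (htT : t < T) (f : ℝ → ℝ) (n : ℕ) :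
    SimpleItoProcess 𝓕 P t T :=
  gridProcess htT (fun s _ ↦ f s) (fun _ _ ↦ measurable_const) (fun _ _ ↦ memLp_const _) n

theorem tendsto_deterministicGridProcess (htT : t < T) {f : ℝ → ℝ} (hf : Continuous f) :
    Tendsto (fun n ↦ eLpNorm (fun p : ℝ × Ω ↦
      (deterministicGridProcess (𝓕 := 𝓕) (P := P) htT f n).val p.1 p.2 - f p.1)
      2 ((volume.restrict (Set.Ioc t T)).prod P)) atTop (𝓝 0) := by
  have key : ∀ ε : ℝ, 0 < ε → ∀ᶠ n in atTop,
      eLpNorm (fun p : ℝ × Ω ↦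
        (deterministicGridProcess (𝓕 := 𝓕) (P := P) htT f n).val p.1 p.2 - f p.1)
        2 ((volume.restrict (Set.Ioc t T)).prod P) ≤
      ENNReal.ofReal ε * (volume.restrict (Set.Ioc t T)) Set.univ ^ (1 / 2 : ℝ) := by
    intro ε hε
    filter_upwards [eventually_grid_close htT hf hε] with n hn
    refine eLpNorm_two_prod_le ?_ ?_
    · exact (deterministicGridProcess htT f n).memLp_val.1.sub
        (hf.measurable.comp measurable_fst).aestronglyMeasurable
    filter_upwards [ae_restrict_mem measurableSet_Ioc] with s hs
    obtain ⟨k, hk, hks, hval⟩ := (deterministicGridProcess (𝓕 := 𝓕) (P := P)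
      htT f n).exists_val_eq hs
    simp only [hval]
    have := hn k hk s (Set.Ioc_subset_Icc_self hks)
    refine (eLpNorm_le_of_ae_bound (C := ε) (Eventually.of_forall fun ω ↦ this)).trans ?_
    simp
  rw [ENNReal.tendsto_nhds_zero]
  intro ε hε
  set K := (volume.restrict (Set.Ioc t T)) Set.univ ^ (1 / 2 : ℝ) with hK
  have hKt : K ≠ ⊤ := by simp [hK]
  have hlim : Tendsto (fun x : ℝ ↦ ENNReal.ofReal x * K) (𝓝[>] 0) (𝓝 0) := by
    have h1 : Tendsto ENNReal.ofReal (𝓝[>] 0) (𝓝 0) := by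
      simpa using (ENNReal.continuous_ofReal.tendsto 0).mono_left nhdsWithin_le_nhds
    simpa using ENNReal.Tendsto.mul_const h1 (b := K) (Or.inr hKt)
  obtain ⟨x, hx, hx0⟩ := ((hlim.eventually_lt_const hε).and self_mem_nhdsWithin).exists
  filter_upwards [key x hx0] with n hn
  exact hn.trans hx.le

/-- The Riemann sums of the stochastic integral `∫_t^T f dw` over the uniform partition. -/
noncomputable def gridSum (w : ℝ → Ω → ℝ) (t T : ℝ) (f : ℝ → ℝ) (n : ℕ) (ω : Ω) : ℝ :=
  ∑ k ∈ Finset.range (n + 1),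
    f (gridNode t T n k) * (w (gridNode t T n (k + 1)) ω - w (gridNode t T n k) ω)

theorem integral_deterministicGridProcess (htT : t < T) (w : ℝ → Ω → ℝ) (f : ℝ → ℝ) (n : ℕ) :
    (deterministicGridProcess (𝓕 := 𝓕) (P := P) htT f n).integral w = gridSum w t T f n := rfl

theorem exists_isItoIntegral_deterministic (hW : IsWienerProcess W 𝓕 S P) (i : Fin m)
    (ht : 0 ≤ t) (htT : t < T) (hTS : T ≤ S) {f : ℝ → ℝ} (hf : Continuous f) :
    ∃ X, IsItoIntegral 𝓕 P (W i) t T (fun s _ ↦ f s) X :=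
  exists_isItoIntegral hW i ht hTS (hf.measurable.comp measurable_fst).aestronglyMeasurable
    (tendsto_deterministicGridProcess htT hf)

theorem IsItoIntegral.tendsto_gridSum (hW : IsWienerProcess W 𝓕 S P) (i : Fin m)
    (ht : 0 ≤ t) (htT : t < T) (hTS : T ≤ S) {f : ℝ → ℝ} (hf : Continuous f) {X : Ω → ℝ}
    (hX : IsItoIntegral 𝓕 P (W i) t T (fun s _ ↦ f s) X) :
    Tendsto (fun n ↦ eLpNorm (fun ω ↦ gridSum (W i) t T f n ω - X ω) 2 P) atTop (𝓝 0) := by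
  have h := hX.tendsto hW i ht hTS (hf.measurable.comp measurable_fst).aestronglyMeasurable
    (tendsto_deterministicGridProcess htT hf)
  simpa only [integral_deterministicGridProcess] using h

theorem memLp_gridSum (hW : IsWienerProcess W 𝓕 S P) (i : Fin m)
    (ht : 0 ≤ t) (htT : t < T) (hTS : T ≤ S) (f : ℝ → ℝ) (n : ℕ) :
    MemLp (gridSum (W i) t T f n) 2 P :=
  SimpleItoProcess.memLp_integral hW i ht hTS (deterministicGridProcess htT f n)

/-- The simple process with the constant value `1`. -/
def SimpleItoProcess.one {a b : ℝ} (hab : a ≤ b) : SimpleItoProcess 𝓕 P a b where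
  n := 1
  node k := if k = 0 then a else b
  coeff _ _ := 1
  node_mono := by
    refine monotone_nat_of_le_succ fun k ↦ ?_
    rcases Nat.eq_zero_or_pos k with rfl | hk
    · simpa using hab
    · simp [hk.ne']
  node_first := by simp
  node_last := by simp
  coeff_measurable _ _ := measurable_const
  coeff_memLp _ _ := memLp_const 1

theorem SimpleItoProcess.eLpNorm_val_one_sub {a b : ℝ} (hab : a ≤ b) :
    eLpNorm (fun p : ℝ × Ω ↦ (SimpleItoProcess.one (𝓕 := 𝓕) (P := P) hab).val p.1 p.2 - 1) 2
      ((volume.restrict (Set.Ioc a b)).prod P) = 0 := by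
  have h := eLpNorm_two_prod_le (C := 0) (f := fun p : ℝ × Ω ↦
    (SimpleItoProcess.one (𝓕 := 𝓕) (P := P) hab).val p.1 p.2 - 1)
    ((SimpleItoProcess.memLp_val _).1.sub aestronglyMeasurable_const) (by
      filter_upwards [ae_restrict_mem measurableSet_Ioc] with s hs
      obtain ⟨k, -, -, hval⟩ := (SimpleItoProcess.one (𝓕 := 𝓕) (P := P) hab).exists_val_eq hs
      have hval' : ∀ ω, (SimpleItoProcess.one (𝓕 := 𝓕) (P := P) hab).val s ω = 1 := hval
      simp [hval'])
  simpa using h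

theorem isItoIntegral_one (hW : IsWienerProcess W 𝓕 S P) (i : Fin m) {a b : ℝ} (ha : 0 ≤ a)
    (hab : a ≤ b) (hb : b ≤ S) :
    IsItoIntegral 𝓕 P (W i) a b (fun _ _ ↦ 1) (fun ω ↦ W i b ω - W i a ω) := by
  refine ⟨hW.memLp_sub i ha hab hb, fun _ ↦ SimpleItoProcess.one hab, ?_, ?_⟩
  · simp only [SimpleItoProcess.eLpNorm_val_one_sub hab]
    exact tendsto_const_nhds
  · simp [SimpleItoProcess.integral, SimpleItoProcess.one]

theorem IsItoIntegral.ae_eq (hW : IsWienerProcess W 𝓕 S P) (i : Fin m) {a b : ℝ} (ha : 0 ≤ a)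
    (hb : b ≤ S) {H : ℝ → Ω → ℝ} {X Y : Ω → ℝ}
    (hH : AEStronglyMeasurable (fun p : ℝ × Ω ↦ H p.1 p.2)
      ((volume.restrict (Set.Ioc a b)).prod P))
    (hX : IsItoIntegral 𝓕 P (W i) a b H X) (hY : IsItoIntegral 𝓕 P (W i) a b H Y) :
    X =ᵐ[P] Y := by
  obtain ⟨hX2, V, hV, hVX⟩ := hX
  exact ae_eq_of_tendsto_eLpNorm
    (fun n ↦ (SimpleItoProcess.memLp_integral hW i ha hb (V n)).1) hX2.1 hY.1.1 hVX
    (hY.tendsto hW i ha hb hH hV)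

end Deterministic

theorem IsItoIntegral.congr_ae {w : ℝ → Ω → ℝ} {a b : ℝ} {H K : ℝ → Ω → ℝ} {X : Ω → ℝ}
    (hX : IsItoIntegral 𝓕 P w a b H X)
    (h : ∀ᵐ ω ∂P, ∀ s ∈ Set.Icc a b, H s ω = K s ω) :
    IsItoIntegral 𝓕 P w a b K X := by
  obtain ⟨hX2, V, hV, hVX⟩ := hX
  refine ⟨hX2, V, hV.congr fun n ↦ eLpNorm_congr_ae ?_, hVX⟩
  have h1 : ∀ᵐ p ∂((volume.restrict (Set.Ioc a b)).prod P), p.1 ∈ Set.Ioc a b :=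
    Measure.quasiMeasurePreserving_fst.ae (ae_restrict_mem measurableSet_Ioc)
  have h2 : ∀ᵐ p ∂((volume.restrict (Set.Ioc a b)).prod P), ∀ s ∈ Set.Icc a b,
      H s p.2 = K s p.2 := Measure.quasiMeasurePreserving_snd.ae h
  filter_upwards [h1, h2] with p hp1 hp2
  simp only [hp2 p.1 (Set.Ioc_subset_Icc_self hp1)]

/-- Two almost surely continuous processes that are modifications of each other are
indistinguishable. -/
theorem ae_forall_eq_of_continuousOn {t T : ℝ} {X Y : ℝ → Ω → ℝ}
    (hX : ∀ᵐ ω ∂P, ContinuousOn (fun s ↦ X s ω) (Set.Icc t T))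
    (hY : ∀ᵐ ω ∂P, ContinuousOn (fun s ↦ Y s ω) (Set.Icc t T))
    (h : ∀ s ∈ Set.Icc t T, X s =ᵐ[P] Y s) :
    ∀ᵐ ω ∂P, ∀ s ∈ Set.Icc t T, X s ω = Y s ω := by
  obtain ⟨D, hDc, hD⟩ := TopologicalSpace.exists_countable_dense (Set.Icc t T)
  have hall : ∀ᵐ ω ∂P, ∀ s ∈ D, X s ω = Y s ω := (ae_ball_iff hDc).2 fun s _ ↦ h s s.2
  filter_upwards [hX, hY, hall] with ω h1 h2 h3 s hs
  have := Continuous.ext_on hD (continuousOn_iff_continuous_domRestrict.1 h1)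
    (continuousOn_iff_continuous_domRestrict.1 h2) fun s hs ↦ h3 s hs
  exact congrFun this ⟨s, hs⟩

theorem IsWienerProcess.continuousOn_sub (hW : IsWienerProcess W 𝓕 S P) (i : Fin m)
    {t T : ℝ} (ht : 0 ≤ t) (hTS : T ≤ S) :
    ∀ᵐ ω ∂P, ContinuousOn (fun s ↦ W i s ω - W i t ω) (Set.Icc t T) := by
  filter_upwards [hW.continuous_paths i] with ω h
  exact (h.mono (Set.Icc_subset_Icc ht hTS)).sub continuousOn_const

theorem IsWienerProcess.measurable_sub_of_mem (hW : IsWienerProcess W 𝓕 S P) (i : Fin m)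
    {t T : ℝ} (ht : 0 ≤ t) (htT : t < T) (hTS : T ≤ S) : ∀ s ∈ Set.Icc t T,
    Measurable[𝓕 s] (fun ω ↦ W i s ω - W i t ω) := fun s hs ↦
  Measurable.sub (hW.adapted i s ⟨ht.trans hs.1, hs.2.trans hTS⟩)
    ((hW.adapted i t ⟨ht, htT.le.trans hTS⟩).mono (𝓕.mono hs.1) le_rfl)

section Iterated

variable [IsProbabilityMeasure P] {t T : ℝ}

/-- The increments `w_s - w_t`, sampled along the uniform partition of `[t, T]`. -/
noncomputable def incrementGridProcess (hW : IsWienerProcess W 𝓕 S P) (i : Fin m)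
    (ht : 0 ≤ t) (htT : t < T) (hTS : T ≤ S) (n : ℕ) : SimpleItoProcess 𝓕 P t T :=
  gridProcess htT (fun s ω ↦ W i s ω - W i t ω) (hW.measurable_sub_of_mem i ht htT hTS)
    (fun _ hs ↦ hW.memLp_sub i ht hs.1 (hs.2.trans hTS)) n

/-- Joint measurability, from the almost sure continuity of the paths. -/
theorem IsWienerProcess.aestronglyMeasurable_sub (hW : IsWienerProcess W 𝓕 S P) (i : Fin m)
    (ht : 0 ≤ t) (htT : t < T) (hTS : T ≤ S) :
    AEStronglyMeasurable (fun p : ℝ × Ω ↦ W i p.1 p.2 - W i t p.2)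
      ((volume.restrict (Set.Ioc t T)).prod P) := by
  refine aestronglyMeasurable_of_tendsto_ae atTop
    (fun n ↦ (incrementGridProcess hW i ht htT hTS n).memLp_val.1) ?_
  have h1 : ∀ᵐ p ∂((volume.restrict (Set.Ioc t T)).prod P), p.1 ∈ Set.Ioc t T :=
    Measure.quasiMeasurePreserving_fst.ae (ae_restrict_mem measurableSet_Ioc)
  have h2 : ∀ᵐ p ∂((volume.restrict (Set.Ioc t T)).prod P),
      ContinuousOn (fun s ↦ W i s p.2 - W i t p.2) (Set.Icc t T) :=
    Measure.quasiMeasurePreserving_snd.ae (hW.continuousOn_sub i ht hTS)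
  filter_upwards [h1, h2] with p hp1 hp2
  choose k hk hks hval using fun n ↦
    (incrementGridProcess hW i ht htT hTS n).exists_val_eq hp1
  simp only [hval]
  have hlim : Tendsto (fun n ↦ gridNode t T n (k n)) atTop (𝓝[Set.Icc t T] p.1) := by
    refine tendsto_nhdsWithin_iff.2 ⟨?_, Eventually.of_forall fun n ↦
      gridNode_mem htT (Nat.le_of_lt (hk n))⟩
    refine tendsto_of_tendsto_of_tendsto_of_le_of_le
      (g := fun n ↦ p.1 - gridMesh t T n) (h := fun _ ↦ p.1)
      (by simpa using tendsto_const_nhds.sub (tendsto_gridMesh t T)) tendsto_const_nhds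
      (fun n ↦ ?_) (fun n ↦ (hks n).1.le)
    have h3 : p.1 ≤ gridNode t T n (k n + 1) := (hks n).2
    rw [gridNode_succ] at h3
    simp only
    linarith
  exact (hp2 p.1 (Set.Ioc_subset_Icc_self hp1)).tendsto.comp hlim

theorem tendsto_incrementGridProcess (hW : IsWienerProcess W 𝓕 S P) (i : Fin m)
    (ht : 0 ≤ t) (htT : t < T) (hTS : T ≤ S) :
    Tendsto (fun n ↦ eLpNorm (fun p : ℝ × Ω ↦
      (incrementGridProcess hW i ht htT hTS n).val p.1 p.2 - (W i p.1 p.2 - W i t p.2))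
      2 ((volume.restrict (Set.Ioc t T)).prod P)) atTop (𝓝 0) := by
  have hC : Tendsto (fun n ↦ ENNReal.ofReal √(gridMesh t T n)) atTop (𝓝 0) := by
    have := ENNReal.tendsto_ofReal
      ((Real.continuous_sqrt.tendsto 0).comp (tendsto_gridMesh t T))
    simpa using this
  refine tendsto_gridProcess htT _ _ (hW.aestronglyMeasurable_sub i ht htT hTS) hC
    (Eventually.of_forall fun n k hk s hs ↦ ?_)
  have h0 : 0 ≤ gridNode t T n k := ht.trans (gridNode_mem htT hk.le).1
  have hsS : s ≤ S := (hs.2.trans (gridNode_mem htT (k := k + 1) hk).2).trans hTS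
  have e : (fun ω ↦ W i (gridNode t T n k) ω - W i t ω - (W i s ω - W i t ω)) =
      fun ω ↦ W i (gridNode t T n k) ω - W i s ω := by ext ω; ring
  rw [e, show (fun ω ↦ W i (gridNode t T n k) ω - W i s ω) =
    W i (gridNode t T n k) - W i s from rfl, eLpNorm_sub_comm]
  have h1 := (hW.memLp_sub i h0 hs.1 hsS).eLpNorm_two_eq_ofReal
  rw [hW.integral_sub_sq i h0 hs.1 hsS] at h1
  refine (show eLpNorm (W i s - W i (gridNode t T n k)) 2 P = _ from h1).trans_le ?_
  have := hs.2
  rw [gridNode_succ] at this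
  gcongr
  linarith

/-- The Riemann sums of the iterated integral `∫_t^T ∫_t^s dv dw` over the uniform partition. -/
noncomputable def iteratedGridSum (v w : ℝ → Ω → ℝ) (t T : ℝ) (n : ℕ) (ω : Ω) : ℝ :=
  ∑ k ∈ Finset.range (n + 1), (v (gridNode t T n k) ω - v t ω) *
    (w (gridNode t T n (k + 1)) ω - w (gridNode t T n k) ω)

theorem memLp_iteratedGridSum (hW : IsWienerProcess W 𝓕 S P) (i j : Fin m)
    (ht : 0 ≤ t) (htT : t < T) (hTS : T ≤ S) (n : ℕ) :
    MemLp (iteratedGridSum (W i) (W j) t T n) 2 P :=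
  SimpleItoProcess.memLp_integral hW j ht hTS (incrementGridProcess hW i ht htT hTS n)

theorem exists_isIteratedItoIntegral (hW : IsWienerProcess W 𝓕 S P) (i j : Fin m)
    (ht : 0 ≤ t) (htT : t < T) (hTS : T ≤ S) :
    ∃ X, IsIteratedItoIntegral 𝓕 P (W i) (W j) t T X := by
  obtain ⟨X, hX⟩ := exists_isItoIntegral (H := fun s ω ↦ W i s ω - W i t ω) hW j ht hTS
    (hW.aestronglyMeasurable_sub i ht htT hTS)
    (tendsto_incrementGridProcess hW i ht htT hTS)
  exact ⟨X, fun s ω ↦ W i s ω - W i t ω,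
    fun s hs ↦ isItoIntegral_one hW i ht hs.1 (hs.2.trans hTS),
    hW.continuousOn_sub i ht hTS, hX⟩

theorem IsIteratedItoIntegral.tendsto_iteratedGridSum (hW : IsWienerProcess W 𝓕 S P)
    (i j : Fin m) (ht : 0 ≤ t) (htT : t < T) (hTS : T ≤ S) {X : Ω → ℝ}
    (hX : IsIteratedItoIntegral 𝓕 P (W i) (W j) t T X) :
    Tendsto (fun n ↦ eLpNorm (fun ω ↦ iteratedGridSum (W i) (W j) t T n ω - X ω) 2 P)
      atTop (𝓝 0) := by
  obtain ⟨Y, hY, hYc, hYX⟩ := hX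
  -- the inner integral is indistinguishable from the increment `w_s - w_t`
  have hYW := ae_forall_eq_of_continuousOn hYc (hW.continuousOn_sub i ht hTS) fun s hs ↦
    (hY s hs).ae_eq hW i ht (hs.2.trans hTS) aestronglyMeasurable_const
      (isItoIntegral_one hW i ht hs.1 (hs.2.trans hTS))
  have h := (hYX.congr_ae hYW).tendsto hW j ht hTS (hW.aestronglyMeasurable_sub i ht htT hTS)
    (tendsto_incrementGridProcess hW i ht htT hTS)
  exact h

end Iterated

end

/-! ### Gaussian laws and independence -/

section

section CharFun

variable {Ω : Type*} {mΩ : MeasurableSpace Ω} {P : Measure Ω} [IsProbabilityMeasure P]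

theorem integral_cexp_gaussianReal (v : NNReal) (c : ℝ) :
    ∫ x, Complex.exp (Complex.I * ((c * x : ℝ) : ℂ)) ∂gaussianReal 0 v =
      Complex.exp (-(((v : ℝ) * c ^ 2 / 2 : ℝ) : ℂ)) := by
  have h := charFun_gaussianReal (μ := 0) (v := v) c
  rw [charFun_apply_real] at h
  convert! h using 1
  · congr 1 with x
    congr 1
    push_cast
    ring
  · congr 1
    push_cast
    ring

/-- A finite family of random variables whose linear combinations have the characteristic functions
of a standard Gaussian vector scaled by `√v` consists of independent Gaussian variables. -/
theorem hasLaw_gaussianReal_and_iIndepFun {ι : Type*} [Fintype ι] {X : ι → Ω → ℝ}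
    (hX : ∀ i, AEMeasurable (X i) P) (v : NNReal)
    (h : ∀ c : ι → ℝ, ∫ ω, Complex.exp (Complex.I * ((∑ i, c i * X i ω : ℝ) : ℂ)) ∂P =
      Complex.exp (-(((v : ℝ) * (∑ i, c i ^ 2) / 2 : ℝ) : ℂ))) :
    (∀ i, HasLaw (X i) (gaussianReal 0 v) P) ∧ iIndepFun X P := by
  classical
  have hlaw : ∀ i, HasLaw (X i) (gaussianReal 0 v) P := by
    refine fun i ↦ ⟨hX i, ?_⟩
    have := Measure.isProbabilityMeasure_map (hX i)
    refine Measure.ext_of_charFun ?_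
    ext u
    rw [charFun_apply_real, charFun_gaussianReal, integral_map (hX i) (by fun_prop)]
    have hu := h (Pi.single i u)
    have e1 : ∀ ω, ∑ j, (Pi.single i u : ι → ℝ) j * X j ω = u * X i ω := fun ω ↦ by
      rw [Finset.sum_eq_single i (fun j _ hj ↦ by simp [hj]) (by simp)]; simp
    have e2 : ∑ j, (Pi.single i u : ι → ℝ) j ^ 2 = u ^ 2 := by
      rw [Finset.sum_eq_single i (fun j _ hj ↦ by simp [hj]) (by simp)]; simp
    simp only [e1, e2] at hu
    convert! hu using 1
    · congr 1 with ω
      congr 1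
      push_cast
      ring
    · congr 1
      push_cast
      ring
  refine ⟨hlaw, (iIndepFun_iff_charFun_pi hX).2 fun u ↦ ?_⟩
  rw [charFun_apply, integral_map (by fun_prop) (by fun_prop)]
  have hu := h fun i ↦ u i
  simp only [PiLp.inner_apply]
  have e : ∀ i, charFun (P.map (X i)) (u i) =
      Complex.exp (-(((v : ℝ) * (u i) ^ 2 / 2 : ℝ) : ℂ)) := fun i ↦ by
    rw [(hlaw i).map_eq, charFun_gaussianReal]
    congr 1
    push_cast
    ring
  simp only [e]
  rw [← Complex.exp_sum]
  convert! hu using 1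
  · congr 1 with ω
    congr 1
    rw [mul_comm]
    simp
  · congr 1
    push_cast
    rw [Finset.sum_neg_distrib, Finset.mul_sum, Finset.sum_div]

/-- Mean square convergence implies the convergence of characteristic functions, because
`|e^{ix} - e^{iy}| ≤ |x - y|`. -/
theorem tendsto_integral_cexp {X : ℕ → Ω → ℝ} {Y : Ω → ℝ}
    (hX : ∀ n, AEStronglyMeasurable (X n) P) (hY : AEStronglyMeasurable Y P)
    (h : Tendsto (fun n ↦ eLpNorm (fun ω ↦ X n ω - Y ω) 2 P) atTop (𝓝 0)) :
    Tendsto (fun n ↦ ∫ ω, Complex.exp (Complex.I * (X n ω : ℂ)) ∂P) atTop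
      (𝓝 (∫ ω, Complex.exp (Complex.I * (Y ω : ℂ)) ∂P)) := by
  have hm : ∀ {Z : Ω → ℝ}, AEStronglyMeasurable Z P →
      AEStronglyMeasurable (fun ω ↦ Complex.exp (Complex.I * (Z ω : ℂ))) P := fun hZ ↦
    (Complex.continuous_exp.comp
      (continuous_const.mul Complex.continuous_ofReal)).comp_aestronglyMeasurable hZ
  have hi : ∀ {Z : Ω → ℝ}, AEStronglyMeasurable Z P →
      Integrable (fun ω ↦ Complex.exp (Complex.I * (Z ω : ℂ))) P := fun hZ ↦
    Integrable.of_bound (hm hZ) 1 (Eventually.of_forall fun ω ↦ by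
      rw [mul_comm, Complex.norm_exp_ofReal_mul_I])
  refine tendsto_integral_of_L1' _ (hm hY) (Eventually.of_forall fun n ↦ hi (hX n)) ?_
  refine tendsto_of_tendsto_of_tendsto_of_le_of_le tendsto_const_nhds h
    (fun _ ↦ zero_le) fun n ↦ ?_
  refine (eLpNorm_mono (g := fun ω ↦ X n ω - Y ω) fun ω ↦ ?_).trans
    (eLpNorm_le_eLpNorm_of_exponent_le (by norm_num) ((hX n).sub hY))
  have e : Complex.exp (Complex.I * (X n ω : ℂ)) - Complex.exp (Complex.I * (Y ω : ℂ)) =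
      Complex.exp (Complex.I * (Y ω : ℂ)) *
        (Complex.exp (Complex.I * ((X n ω - Y ω : ℝ) : ℂ)) - 1) := by
    rw [mul_sub, ← Complex.exp_add, mul_one]
    congr 2
    push_cast
    ring
  rw [Pi.sub_apply, e, norm_mul, mul_comm Complex.I (Y ω : ℂ), Complex.norm_exp_ofReal_mul_I,
    one_mul]
  exact Real.norm_exp_I_mul_ofReal_sub_one_le

end CharFun

variable {Ω : Type*} {mΩ : MeasurableSpace Ω} {P : Measure Ω}
  {𝓕 : Filtration ℝ mΩ} {m : ℕ} {W : Fin m → ℝ → Ω → ℝ} {S t T : ℝ}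

/-- The increment of `w` over the `l`-th interval of the uniform partition. -/
noncomputable def gridIncrement (w : ℝ → Ω → ℝ) (t T : ℝ) (n l : ℕ) (ω : Ω) : ℝ :=
  w (gridNode t T n (l + 1)) ω - w (gridNode t T n l) ω

theorem IsWienerProcess.integral_cexp_increment (hW : IsWienerProcess W 𝓕 S P) {s u : ℝ}
    (hs : 0 ≤ s) (hsu : s ≤ u) (hu : u ≤ S) (c : Fin m → ℝ) :
    ∫ ω, Complex.exp (Complex.I * ((∑ i, c i * (W i u ω - W i s ω) : ℝ) : ℂ)) ∂P =
      Complex.exp (-(((u - s) * (∑ i, c i ^ 2) / 2 : ℝ) : ℂ)) := by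
  have hl := hW.law_increment s u hs hsu hu
  have h1 := hl.integral_comp (f := fun x : Fin m → ℝ ↦
    Complex.exp (Complex.I * ((∑ i, c i * x i : ℝ) : ℂ)))
    (Measurable.aestronglyMeasurable (by fun_prop))
  have h2 : ∀ x : Fin m → ℝ, Complex.exp (Complex.I * ((∑ i, c i * x i : ℝ) : ℂ)) =
      ∏ i, Complex.exp (Complex.I * ((c i * x i : ℝ) : ℂ)) := fun x ↦ by
    rw [← Complex.exp_sum, ← Finset.mul_sum]; push_cast; rfl
  simp only [Function.comp_def, h2] at h1
  rw [integral_fintype_prod_eq_prod (𝕜 := ℂ)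
    (f := fun i x ↦ Complex.exp (Complex.I * ((c i * x : ℝ) : ℂ)))] at h1
  simp only [integral_cexp_gaussianReal, Real.coe_toNNReal _ (sub_nonneg.2 hsu)] at h1
  rw [← Complex.exp_sum] at h1
  simp only [← h2] at h1
  rw [h1]
  congr 1
  push_cast
  rw [Finset.sum_neg_distrib, Finset.mul_sum, Finset.sum_div]

/-- The joint characteristic function of the increments over the uniform partition, by induction on
the number of intervals: each vector of increments is independent of the past. -/
theorem IsWienerProcess.integral_cexp_gridIncrement [IsProbabilityMeasure P]
    (hW : IsWienerProcess W 𝓕 S P)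
    (ht : 0 ≤ t) (htT : t < T) (hTS : T ≤ S) (n : ℕ) (c : Fin m → ℕ → ℝ) :
    ∀ k ≤ n + 1, ∫ ω, Complex.exp (Complex.I * ((∑ l ∈ Finset.range k,
      ∑ i, c i l * gridIncrement (W i) t T n l ω : ℝ) : ℂ)) ∂P =
      Complex.exp (-((gridMesh t T n * (∑ l ∈ Finset.range k, ∑ i, c i l ^ 2) / 2 : ℝ) : ℂ)) := by
  intro k
  induction k with
  | zero => intro _; simp
  | succ k ih =>
    intro hk
    have hnode : ∀ {l : ℕ}, l ≤ k + 1 → gridNode t T n l ∈ Set.Icc 0 S := fun {l} hl ↦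
      ⟨ht.trans (gridNode_mem htT (hl.trans hk)).1, (gridNode_mem htT (hl.trans hk)).2.trans hTS⟩
    have hle := gridNode_mono htT n (Nat.le_succ k)
    have hA : Measurable[𝓕 (gridNode t T n k)] fun ω ↦
        ∑ l ∈ Finset.range k, ∑ i, c i l * gridIncrement (W i) t T n l ω := by
      refine Finset.measurable_sum _ fun l hl ↦ Finset.measurable_sum _ fun i _ ↦
        Measurable.const_mul (Measurable.sub ?_ ?_) _
      · have hl' : l + 1 ≤ k := Finset.mem_range.1 hl
        exact (hW.adapted i _ (hnode (by omega))).mono (𝓕.mono (gridNode_mono htT n hl')) le_rfl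
      · have hl' : l ≤ k := (Finset.mem_range.1 hl).le
        exact (hW.adapted i _ (hnode (by omega))).mono (𝓕.mono (gridNode_mono htT n hl')) le_rfl
    have hB : Measurable fun ω ↦ ∑ i, c i k * gridIncrement (W i) t T n k ω :=
      Finset.measurable_sum _ fun i _ ↦ Measurable.const_mul (Measurable.sub
        (hW.measurable i (hnode le_rfl)) (hW.measurable i (hnode (Nat.le_succ k)))) _
    have hind : IndepFun (fun ω ↦ ∑ l ∈ Finset.range k, ∑ i, c i l * gridIncrement (W i) t T n l ω)
        (fun ω ↦ ∑ i, c i k * gridIncrement (W i) t T n k ω) P := by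
      have h := indep_of_indep_of_le_right (hW.indep_increment _ _ (hnode (Nat.le_succ k)).1 hle
        (hnode le_rfl).2) hA.comap_le
      refine (indep_of_indep_of_le_left h (m₃ := MeasurableSpace.comap
        (fun ω ↦ ∑ i, c i k * gridIncrement (W i) t T n k ω) inferInstance) ?_).symm
      have hg : Measurable fun x : Fin m → ℝ ↦ ∑ i, c i k * x i := by fun_prop
      exact MeasurableSpace.comap_le_iff_le_map.2 fun A hA ↦ ⟨_, hg hA, rfl⟩
    have hmul := hind.integral_fun_comp_mul_comp (𝕜 := ℂ)
      (f := fun x : ℝ ↦ Complex.exp (Complex.I * (x : ℂ)))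
      (g := fun x : ℝ ↦ Complex.exp (Complex.I * (x : ℂ)))
      (hA.mono (𝓕.le _) le_rfl).aemeasurable hB.aemeasurable (by fun_prop) (by fun_prop)
    rw [ih (by omega)] at hmul
    have hinc := hW.integral_cexp_increment (hnode (Nat.le_succ k)).1 hle (hnode le_rfl).2
      (fun i ↦ c i k)
    rw [gridNode_succ, add_sub_cancel_left, ← gridNode_succ] at hinc
    simp only [gridIncrement] at hmul hinc ⊢
    rw [hinc, ← Complex.exp_add] at hmul
    simp only [Finset.sum_range_succ _ k]
    convert! hmul using 1
    · congr 1 with ω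
      rw [← Complex.exp_add]
      congr 1
      push_cast
      ring
    · congr 1
      push_cast
      ring

theorem IsWienerProcess.gridIncrement_gaussian [IsProbabilityMeasure P]
    (hW : IsWienerProcess W 𝓕 S P)
    (ht : 0 ≤ t) (htT : t < T) (hTS : T ≤ S) (n : ℕ) :
    (∀ p : Fin m × Fin (n + 1), HasLaw (gridIncrement (W p.1) t T n p.2)
      (gaussianReal 0 (gridMesh t T n).toNNReal) P) ∧
    iIndepFun (fun p : Fin m × Fin (n + 1) ↦ gridIncrement (W p.1) t T n p.2) P := by
  refine hasLaw_gaussianReal_and_iIndepFun (fun p ↦ ?_) _ fun c ↦ ?_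
  · have h1 := gridNode_mem htT (n := n) (k := p.2 + 1) (by omega)
    have h0 := gridNode_mem htT (n := n) (k := p.2) (by omega)
    exact ((hW.measurable p.1 ⟨ht.trans h1.1, h1.2.trans hTS⟩).sub
      (hW.measurable p.1 ⟨ht.trans h0.1, h0.2.trans hTS⟩)).aemeasurable
  · have h := hW.integral_cexp_gridIncrement ht htT hTS n
      (fun i l ↦ if hl : l < n + 1 then c (i, ⟨l, hl⟩) else 0) (n + 1) le_rfl
    simp only [Finset.sum_range] at h
    rw [Real.coe_toNNReal _ (gridMesh_pos htT n).le]
    simp only [Fin.is_lt, dif_pos, Fin.eta] at h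
    simp only [Fintype.sum_prod_type_right]
    exact h

/-- The stochastic integrals of the normalized Legendre polynomials are independent standard
Gaussian variables: their joint characteristic function is the limit of those of the
Riemann sums. -/
theorem IsWienerProcess.legendre_gaussian [IsProbabilityMeasure P]
    (hW : IsWienerProcess W 𝓕 S P)
    (ht : 0 ≤ t) (htT : t < T) (hTS : T ≤ S) {ζ : Fin m → ℕ → Ω → ℝ}
    (hζ : ∀ i j, IsItoIntegral 𝓕 P (W i) t T (fun s _ ↦ legendrePhi t T j s) (ζ i j))
    (F : Finset (Fin m × ℕ)) :
    (∀ p : F, HasLaw (ζ p.1.1 p.1.2) (gaussianReal 0 1) P) ∧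
      iIndepFun (fun p : F ↦ ζ p.1.1 p.1.2) P := by
  classical
  refine hasLaw_gaussianReal_and_iIndepFun (fun p ↦ (hζ _ _).1.1.aemeasurable) 1 fun c ↦ ?_
  set G : ℕ → Ω → ℝ := fun n ω ↦ ∑ p : F, c p *
    gridSum (W p.1.1) t T (legendrePhi t T p.1.2) n ω with hG
  have hGm : ∀ n, AEStronglyMeasurable (G n) P := fun n ↦
    (memLp_finsetSum _ fun p _ ↦ (memLp_gridSum hW p.1.1 ht htT hTS _ n).const_mul (c p)).1
  have hZm : AEStronglyMeasurable (fun ω ↦ ∑ p : F, c p * ζ p.1.1 p.1.2 ω) P :=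
    (memLp_finsetSum _ fun p _ ↦ (hζ p.1.1 p.1.2).1.const_mul (c p)).1
  have hlim : Tendsto (fun n ↦ eLpNorm (fun ω ↦ G n ω - ∑ p : F, c p * ζ p.1.1 p.1.2 ω) 2 P)
      atTop (𝓝 0) := by
    have h0 : Tendsto (fun n ↦ ∑ p : F, ‖c p‖ₑ * eLpNorm (fun ω ↦
        gridSum (W p.1.1) t T (legendrePhi t T p.1.2) n ω - ζ p.1.1 p.1.2 ω) 2 P)
        atTop (𝓝 0) := by
      rw [show (0 : ENNReal) = ∑ p : F, ‖c p‖ₑ * 0 by simp]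
      refine tendsto_finsetSum _ fun p _ ↦ ENNReal.Tendsto.const_mul
        ((hζ p.1.1 p.1.2).tendsto_gridSum hW _ ht htT hTS (continuous_legendrePhi t T _))
        (Or.inr (by simp))
    refine tendsto_of_tendsto_of_tendsto_of_le_of_le tendsto_const_nhds h0
      (fun _ ↦ zero_le) fun n ↦ ?_
    have e : (fun ω ↦ G n ω - ∑ p : F, c p * ζ p.1.1 p.1.2 ω) = ∑ p : F, c p • fun ω ↦
        gridSum (W p.1.1) t T (legendrePhi t T p.1.2) n ω - ζ p.1.1 p.1.2 ω := by
      ext ω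
      simp only [hG, ← Finset.sum_sub_distrib, Finset.sum_apply, Pi.smul_apply, smul_eq_mul,
        mul_sub]
    simp only [e]
    refine (eLpNorm_sum_le (fun p _ ↦ AEStronglyMeasurable.const_smul
      ((memLp_gridSum hW p.1.1 ht htT hTS _ n).1.sub (hζ _ _).1.1) _) (by norm_num)).trans_eq ?_
    exact Finset.sum_congr rfl fun p _ ↦ eLpNorm_const_smul _ _ _ _
  have h1 := tendsto_integral_cexp hGm hZm hlim
  refine tendsto_nhds_unique h1 ?_
  -- the coefficients of the increments in the Riemann sums
  set d : ℕ → Fin m → ℕ → ℝ := fun n i l ↦ ∑ p : F, if p.1.1 = i then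
    c p * legendrePhi t T p.1.2 (gridNode t T n l) else 0 with hd
  have hGd : ∀ n ω, G n ω = ∑ l ∈ Finset.range (n + 1), ∑ i,
      d n i l * gridIncrement (W i) t T n l ω := by
    intro n ω
    simp only [hG, hd, gridSum, Finset.mul_sum, Finset.sum_mul]
    rw [Finset.sum_comm]
    refine Finset.sum_congr rfl fun l _ ↦ ?_
    rw [Finset.sum_comm]
    refine Finset.sum_congr rfl fun p _ ↦ ?_
    simp only [ite_mul, zero_mul, Finset.sum_ite_eq, Finset.mem_univ, if_true, gridIncrement,
      mul_assoc]
  have hd2 : ∀ n l, ∑ i, d n i l ^ 2 = ∑ p : F, ∑ q : F, if p.1.1 = q.1.1 then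
      c p * c q * (legendrePhi t T p.1.2 (gridNode t T n l) *
        legendrePhi t T q.1.2 (gridNode t T n l)) else 0 := by
    intro n l
    simp only [hd, sq, Finset.sum_mul_sum]
    rw [Finset.sum_comm]
    refine Finset.sum_congr rfl fun p _ ↦ ?_
    rw [Finset.sum_comm]
    refine Finset.sum_congr rfl fun q _ ↦ ?_
    simp only [ite_mul, zero_mul, Finset.sum_ite_eq, Finset.mem_univ, if_true, mul_ite, mul_zero]
    by_cases hpq : p.1.1 = q.1.1
    · rw [if_pos hpq, if_pos hpq]; ring
    · rw [if_neg hpq, if_neg hpq]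
  have hvar : Tendsto (fun n ↦ gridMesh t T n * ∑ l ∈ Finset.range (n + 1), ∑ i, d n i l ^ 2)
      atTop (𝓝 (∑ p, c p ^ 2)) := by
    have e : ∀ n, gridMesh t T n * ∑ l ∈ Finset.range (n + 1), ∑ i, d n i l ^ 2 =
        ∑ p : F, ∑ q : F, if p.1.1 = q.1.1 then c p * c q * (gridMesh t T n *
          ∑ l ∈ Finset.range (n + 1), legendrePhi t T p.1.2 (gridNode t T n l) *
            legendrePhi t T q.1.2 (gridNode t T n l)) else 0 := by
      intro n
      simp only [hd2]
      rw [Finset.sum_comm, Finset.mul_sum]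
      refine Finset.sum_congr rfl fun p _ ↦ ?_
      rw [Finset.sum_comm, Finset.mul_sum]
      refine Finset.sum_congr rfl fun q _ ↦ ?_
      split_ifs
      · rw [← Finset.mul_sum]; ring
      · simp
    simp only [e]
    have hval : ∑ p, c p ^ 2 = ∑ p : F, ∑ q : F, if p.1.1 = q.1.1 then c p * c q *
        (∫ s in t..T, legendrePhi t T p.1.2 s * legendrePhi t T q.1.2 s) else 0 := by
      refine Finset.sum_congr rfl fun p _ ↦ ?_
      rw [Finset.sum_eq_single p]
      · rw [if_pos rfl, integral_legendrePhi_mul htT, if_pos rfl]; ring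
      · intro q _ hqp
        split_ifs with h
        · rw [integral_legendrePhi_mul htT, if_neg, mul_zero]
          exact fun h' ↦ hqp (Subtype.ext (Prod.ext h.symm h'.symm))
        · rfl
      · simp
    rw [hval]
    refine tendsto_finsetSum _ fun p _ ↦ tendsto_finsetSum _ fun q _ ↦ ?_
    split_ifs
    · exact (tendsto_riemann_sum htT ((continuous_legendrePhi t T _).mul
        (continuous_legendrePhi t T _))).const_mul _
    · exact tendsto_const_nhds
  have hchar : ∀ n, ∫ ω, Complex.exp (Complex.I * (G n ω : ℂ)) ∂P = Complex.exp
      (-((gridMesh t T n * (∑ l ∈ Finset.range (n + 1), ∑ i, d n i l ^ 2) / 2 : ℝ) : ℂ)) := by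
    intro n
    simp only [hGd]
    exact hW.integral_cexp_gridIncrement ht htT hTS n (d n) (n + 1) le_rfl
  simp only [hchar]
  have hcont : Continuous fun x : ℝ ↦ Complex.exp (-((x / 2 : ℝ) : ℂ)) := by fun_prop
  simp only [NNReal.coe_one, one_mul]
  exact (hcont.tendsto _).comp hvar

end

/-! ### The mean square error of the expansion -/

section

section General

variable {α : Type*} {mα : MeasurableSpace α} {μ : Measure α}

theorem integral_sq_sum_of_orthogonal {ι : Type*} [DecidableEq ι] {s : Finset ι} {Z : ι → α → ℝ}
    (hZ : ∀ q ∈ s, MemLp (Z q) 2 μ) {v : ℝ}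
    (horth : ∀ q ∈ s, ∀ r ∈ s, ∫ x, Z q x * Z r x ∂μ = if q = r then v else 0) (c : ι → ℝ) :
    ∫ x, (∑ q ∈ s, c q * Z q x) ^ 2 ∂μ = v * ∑ q ∈ s, c q ^ 2 := by
  have hi : ∀ q ∈ s, ∀ r ∈ s, Integrable (fun x ↦ c q * Z q x * (c r * Z r x)) μ :=
    fun q hq r hr ↦ ((hZ q hq).const_mul (c q)).integrable_fun_mul ((hZ r hr).const_mul (c r))
  simp only [sq, Finset.sum_mul_sum]
  rw [integral_finsetSum _ fun q hq ↦ integrable_finsetSum _ fun r hr ↦ hi q hq r hr,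
    Finset.mul_sum]
  refine Finset.sum_congr rfl fun q hq ↦ ?_
  rw [integral_finsetSum _ fun r hr ↦ hi q hq r hr, Finset.sum_eq_single_of_mem q hq]
  · have e : ∀ x, c q * Z q x * (c q * Z q x) = c q * c q * (Z q x * Z q x) := fun x ↦ by ring
    simp only [e]
    rw [integral_const_mul, horth q hq q hq, if_pos rfl, mul_comm]
  · intro r hr hrq
    have e : ∀ x, c q * Z q x * (c r * Z r x) = c q * c r * (Z q x * Z r x) := fun x ↦ by ring
    simp only [e]
    rw [integral_const_mul, horth q hq r hr, if_neg (Ne.symm hrq), mul_zero]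

/-- Finitely many `L²`-convergent sequences converge almost surely along a common subsequence. -/
theorem exists_subseq_forall_tendsto_ae {ι : Type*} (s : Finset ι) {X : ι → ℕ → α → ℝ}
    {Y : ι → α → ℝ} (hX : ∀ i n, AEStronglyMeasurable (X i n) μ)
    (hY : ∀ i, AEStronglyMeasurable (Y i) μ)
    (h : ∀ i ∈ s, Tendsto (fun n ↦ eLpNorm (fun x ↦ X i n x - Y i x) 2 μ) atTop (𝓝 0)) :
    ∃ ns : ℕ → ℕ, StrictMono ns ∧
      ∀ᵐ x ∂μ, ∀ i ∈ s, Tendsto (fun k ↦ X i (ns k) x) atTop (𝓝 (Y i x)) := by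
  classical
  induction s using Finset.induction with
  | empty => exact ⟨id, strictMono_id, by simp⟩
  | insert i s _ ih =>
    obtain ⟨ns, hns, hae⟩ := ih fun j hj ↦ h j (Finset.mem_insert_of_mem hj)
    have hi : Tendsto (fun k ↦ eLpNorm (X i (ns k) - Y i) 2 μ) atTop (𝓝 0) :=
      (h i (Finset.mem_insert_self i s)).comp hns.tendsto_atTop
    obtain ⟨ms, hms, hae'⟩ := (tendstoInMeasure_of_tendsto_eLpNorm (by norm_num)
      (fun k ↦ hX i (ns k)) (hY i) hi).exists_seq_tendsto_ae
    refine ⟨ns ∘ ms, hns.comp hms, ?_⟩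
    filter_upwards [hae, hae'] with x hx hx' j hj
    rcases Finset.mem_insert.1 hj with rfl | hj
    · exact hx'
    · exact (hx j hj).comp hms.tendsto_atTop

end General

variable {Ω : Type*} {mΩ : MeasurableSpace Ω} {P : Measure Ω}
  {𝓕 : Filtration ℝ mΩ} {m : ℕ} {W : Fin m → ℝ → Ω → ℝ} {S t T : ℝ}

section GridMoments

theorem memLp_gridIncrement (hW : IsWienerProcess W 𝓕 S P) (i : Fin m)
    (ht : 0 ≤ t) (htT : t < T) (hTS : T ≤ S) {n l : ℕ} (hl : l < n + 1) :
    MemLp (gridIncrement (W i) t T n l) 2 P :=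
  hW.memLp_sub i (ht.trans (gridNode_mem htT hl.le).1) (gridNode_mono htT n (Nat.le_succ l))
    ((gridNode_mem htT (k := l + 1) hl).2.trans hTS)

theorem integral_gridIncrement_mul [IsProbabilityMeasure P]
    (hW : IsWienerProcess W 𝓕 S P) (i : Fin m)
    (ht : 0 ≤ t) (htT : t < T) (hTS : T ≤ S) {n l l' : ℕ} (hl : l < n + 1) (hl' : l' < n + 1) :
    ∫ ω, gridIncrement (W i) t T n l ω * gridIncrement (W i) t T n l' ω ∂P =
      if l = l' then gridMesh t T n else 0 := by
  have h0 := ht.trans (gridNode_mem htT hl.le).1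
  have h1 := gridNode_mono htT n (Nat.le_succ l)
  have h2 := (gridNode_mem htT (k := l + 1) hl).2.trans hTS
  split_ifs with h
  · subst h
    have := hW.integral_sub_sq i h0 h1 h2
    rw [gridNode_succ, add_sub_cancel_left, ← gridNode_succ] at this
    rw [← this]
    congr 1 with ω
    rw [sq, gridIncrement]
  · have hind := (hW.gridIncrement_gaussian ht htT hTS n).2.indepFun
      (i := (i, ⟨l, hl⟩)) (j := (i, ⟨l', hl'⟩)) (by simpa using h)
    have := hind.integral_fun_mul_eq_mul_integral
      (memLp_gridIncrement hW i ht htT hTS hl).1 (memLp_gridIncrement hW i ht htT hTS hl').1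
    refine this.trans ?_
    have h3 := hW.integral_sub i h0 h1 h2
    exact mul_eq_zero_of_left h3 _

theorem memLp_gridIncrement_mul [IsProbabilityMeasure P]
    (hW : IsWienerProcess W 𝓕 S P) {i j : Fin m} (hij : i ≠ j)
    (ht : 0 ≤ t) (htT : t < T) (hTS : T ≤ S) {n l k : ℕ} (hl : l < n + 1) (hk : k < n + 1) :
    MemLp (fun ω ↦ gridIncrement (W i) t T n l ω * gridIncrement (W j) t T n k ω) 2 P :=
  ((hW.gridIncrement_gaussian ht htT hTS n).2.indepFun
    (i := (i, ⟨l, hl⟩)) (j := (j, ⟨k, hk⟩)) (by simp [hij])).memLp_two_mul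
    (memLp_gridIncrement hW i ht htT hTS hl) (memLp_gridIncrement hW j ht htT hTS hk)

/-- The products of increments of two different components are orthogonal. -/
theorem integral_gridIncrement_mul_mul [IsProbabilityMeasure P]
    (hW : IsWienerProcess W 𝓕 S P) {i j : Fin m} (hij : i ≠ j)
    (ht : 0 ≤ t) (htT : t < T) (hTS : T ≤ S) {n l l' k k' : ℕ} (hl : l < n + 1)
    (hl' : l' < n + 1) (hk : k < n + 1) (hk' : k' < n + 1) :
    ∫ ω, (gridIncrement (W i) t T n l ω * gridIncrement (W j) t T n k ω) *
      (gridIncrement (W i) t T n l' ω * gridIncrement (W j) t T n k' ω) ∂P =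
      if (l, k) = (l', k') then gridMesh t T n ^ 2 else 0 := by
  have hg := hW.gridIncrement_gaussian ht htT hTS n
  have hind := hg.2.indepFun_prodMk_prodMk₀ (fun p ↦ (hg.1 p).aemeasurable)
    (i, ⟨l, hl⟩) (i, ⟨l', hl'⟩) (j, ⟨k, hk⟩) (j, ⟨k', hk'⟩)
    (by simp [hij]) (by simp [hij]) (by simp [hij]) (by simp [hij])
  have hind2 := hind.comp (φ := fun x : ℝ × ℝ ↦ x.1 * x.2) (ψ := fun x : ℝ × ℝ ↦ x.1 * x.2)
    (by fun_prop) (by fun_prop)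
  have h := hind2.integral_fun_mul_eq_mul_integral
    ((memLp_gridIncrement hW i ht htT hTS hl).1.mul (memLp_gridIncrement hW i ht htT hTS hl').1)
    ((memLp_gridIncrement hW j ht htT hTS hk).1.mul (memLp_gridIncrement hW j ht htT hTS hk').1)
  simp only [Function.comp_apply] at h
  have e : ∀ ω, (gridIncrement (W i) t T n l ω * gridIncrement (W j) t T n k ω) *
      (gridIncrement (W i) t T n l' ω * gridIncrement (W j) t T n k' ω) =
      (gridIncrement (W i) t T n l ω * gridIncrement (W i) t T n l' ω) *
      (gridIncrement (W j) t T n k ω * gridIncrement (W j) t T n k' ω) := fun ω ↦ by ring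
  simp only [e]
  rw [h, integral_gridIncrement_mul hW i ht htT hTS hl hl',
    integral_gridIncrement_mul hW j ht htT hTS hk hk']
  by_cases h1 : l = l' <;> by_cases h2 : k = k' <;> simp [h1, h2, sq]

end GridMoments

section Expansion

/-- The Fourier coefficient `∫_t^T φ_{p₂}(s) ∫_t^s φ_{p₁}(x) dx ds` of the indicator function of the
triangle `x < s`. -/
noncomputable def triangleCoeff (t T : ℝ) (p : ℕ × ℕ) : ℝ :=
  ∫ s in t..T, legendrePhi t T p.2 s * ∫ x in t..s, legendrePhi t T p.1 x

/-- The Riemann sum of the iterated integral minus a finite combination of products of Riemann sums,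
as a double sum over the products of the increments. -/
theorem iteratedGridSum_sub_eq (v w : ℝ → Ω → ℝ) (F : Finset (ℕ × ℕ)) (a : ℕ × ℕ → ℝ) (n : ℕ)
    (ω : Ω) :
    iteratedGridSum v w t T n ω - ∑ p ∈ F, a p *
      (gridSum v t T (legendrePhi t T p.1) n ω * gridSum w t T (legendrePhi t T p.2) n ω) =
    ∑ q ∈ Finset.range (n + 1) ×ˢ Finset.range (n + 1),
      ((if q.1 < q.2 then 1 else 0) - ∑ p ∈ F, a p * (legendrePhi t T p.1 (gridNode t T n q.1) *
        legendrePhi t T p.2 (gridNode t T n q.2))) *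
      (gridIncrement v t T n q.1 ω * gridIncrement w t T n q.2 ω) := by
  simp only [sub_mul, Finset.sum_sub_distrib]
  congr 1
  · rw [Finset.sum_product_right, iteratedGridSum]
    refine Finset.sum_congr rfl fun k hk ↦ ?_
    have hk' := Finset.mem_range.1 hk
    have e : v (gridNode t T n k) ω - v t ω =
        ∑ l ∈ Finset.range k, gridIncrement v t T n l ω := by
      simp only [gridIncrement]
      rw [Finset.sum_range_sub (fun l ↦ v (gridNode t T n l) ω), gridNode_zero]
    rw [e, Finset.sum_mul]
    simp only [ite_mul, one_mul, zero_mul]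
    rw [← Finset.sum_filter]
    refine Finset.sum_congr ?_ fun l _ ↦ rfl
    ext l
    simp only [Finset.mem_range, Finset.mem_filter]
    omega
  · simp only [Finset.sum_mul]
    rw [Finset.sum_comm]
    refine Finset.sum_congr rfl fun p _ ↦ ?_
    rw [Finset.sum_product, gridSum, gridSum, Finset.sum_mul_sum, Finset.mul_sum]
    refine Finset.sum_congr rfl fun l _ ↦ ?_
    rw [Finset.mul_sum]
    refine Finset.sum_congr rfl fun k _ ↦ ?_
    simp only [gridIncrement]
    ring

/-- The discrete version of `‖1_{x < s} - ∑ C_p φ_{p₁} ⊗ φ_{p₂}‖² = (T - t)² / 2 - ∑ C_p²`. -/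
theorem tendsto_sum_sq_triangle_sub (htT : t < T) (F : Finset (ℕ × ℕ)) :
    Tendsto (fun n ↦ gridMesh t T n ^ 2 *
      ∑ q ∈ Finset.range (n + 1) ×ˢ Finset.range (n + 1),
        ((if q.1 < q.2 then 1 else 0) - ∑ p ∈ F, triangleCoeff t T p *
          (legendrePhi t T p.1 (gridNode t T n q.1) *
            legendrePhi t T p.2 (gridNode t T n q.2))) ^ 2) atTop
      (𝓝 ((T - t) ^ 2 / 2 - ∑ p ∈ F, triangleCoeff t T p ^ 2)) := by
  set φ := legendrePhi t T with hφ
  set C := triangleCoeff t T with hC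
  have hφc : ∀ j, Continuous (φ j) := continuous_legendrePhi t T
  have tri : ∀ n (g : ℕ × ℕ → ℝ), ∑ q ∈ Finset.range (n + 1) ×ˢ Finset.range (n + 1),
      (if q.1 < q.2 then 1 else 0) * g q =
      ∑ k ∈ Finset.range (n + 1), ∑ l ∈ Finset.range k, g (l, k) := by
    intro n g
    rw [Finset.sum_product_right]
    refine Finset.sum_congr rfl fun k hk ↦ ?_
    have hk' := Finset.mem_range.1 hk
    simp only [ite_mul, one_mul, zero_mul]
    rw [← Finset.sum_filter]
    refine Finset.sum_congr ?_ fun l _ ↦ rfl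
    ext l
    simp only [Finset.mem_range, Finset.mem_filter]
    omega
  have expand : ∀ n, gridMesh t T n ^ 2 *
      ∑ q ∈ Finset.range (n + 1) ×ˢ Finset.range (n + 1),
        ((if q.1 < q.2 then 1 else 0) - ∑ p ∈ F, C p *
          (φ p.1 (gridNode t T n q.1) * φ p.2 (gridNode t T n q.2))) ^ 2 =
      gridMesh t T n ^ 2 * ∑ k ∈ Finset.range (n + 1), ∑ l ∈ Finset.range k, (1 : ℝ) * 1 -
      2 * ∑ p ∈ F, C p * (gridMesh t T n ^ 2 * ∑ k ∈ Finset.range (n + 1),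
        ∑ l ∈ Finset.range k, φ p.1 (gridNode t T n l) * φ p.2 (gridNode t T n k)) +
      ∑ p ∈ F, ∑ r ∈ F, C p * C r *
        ((gridMesh t T n * ∑ l ∈ Finset.range (n + 1),
            φ p.1 (gridNode t T n l) * φ r.1 (gridNode t T n l)) *
          (gridMesh t T n * ∑ k ∈ Finset.range (n + 1),
            φ p.2 (gridNode t T n k) * φ r.2 (gridNode t T n k))) := by
    intro n
    have e : ∀ q : ℕ × ℕ, ((if q.1 < q.2 then 1 else 0) - ∑ p ∈ F, C p *
          (φ p.1 (gridNode t T n q.1) * φ p.2 (gridNode t T n q.2))) ^ 2 =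
        (if q.1 < q.2 then 1 else 0) * ((1 : ℝ) * 1) -
        2 * ∑ p ∈ F, C p * ((if q.1 < q.2 then 1 else 0) *
          (φ p.1 (gridNode t T n q.1) * φ p.2 (gridNode t T n q.2))) +
        ∑ p ∈ F, ∑ r ∈ F, C p * C r *
          ((φ p.1 (gridNode t T n q.1) * φ r.1 (gridNode t T n q.1)) *
            (φ p.2 (gridNode t T n q.2) * φ r.2 (gridNode t T n q.2))) := by
      intro q
      have e1 : ∑ p ∈ F, ∑ r ∈ F, C p * C r *
          ((φ p.1 (gridNode t T n q.1) * φ r.1 (gridNode t T n q.1)) *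
            (φ p.2 (gridNode t T n q.2) * φ r.2 (gridNode t T n q.2))) =
          (∑ p ∈ F, C p * (φ p.1 (gridNode t T n q.1) * φ p.2 (gridNode t T n q.2))) ^ 2 := by
        rw [sq, Finset.sum_mul_sum]
        exact Finset.sum_congr rfl fun p _ ↦ Finset.sum_congr rfl fun r _ ↦ by ring
      rw [e1]
      split_ifs
      · simp only [one_mul]; ring
      · simp
    simp only [e]
    rw [Finset.sum_add_distrib, Finset.sum_sub_distrib, mul_add, mul_sub, tri n fun _ ↦ 1 * 1,
      ← Finset.mul_sum]
    congr 1
    · congr 1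
      rw [mul_left_comm, Finset.sum_comm, Finset.mul_sum]
      congr 1
      refine Finset.sum_congr rfl fun p _ ↦ ?_
      rw [← Finset.mul_sum, tri n fun q ↦ φ p.1 (gridNode t T n q.1) * φ p.2 (gridNode t T n q.2)]
      ring
    · rw [Finset.sum_comm, Finset.mul_sum]
      refine Finset.sum_congr rfl fun p _ ↦ ?_
      rw [Finset.sum_comm, Finset.mul_sum]
      refine Finset.sum_congr rfl fun r _ ↦ ?_
      rw [← Finset.mul_sum, Finset.sum_product]
      simp only [← Finset.mul_sum, ← Finset.sum_mul]
      ring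
  have hone : ∫ s in t..T, (1 : ℝ) * ∫ x in t..s, (1 : ℝ) = (T - t) ^ 2 / 2 := by
    simp only [intervalIntegral.integral_const, smul_eq_mul, mul_one, one_mul]
    rw [intervalIntegral.integral_sub (by simp) (by simp), integral_id,
      intervalIntegral.integral_const, smul_eq_mul]
    ring
  have h1 := tendsto_iterated_riemann_sum htT (f := fun _ ↦ 1) (g := fun _ ↦ 1)
    continuous_const continuous_const
  rw [hone] at h1
  have h2 : Tendsto (fun n ↦ ∑ p ∈ F, C p * (gridMesh t T n ^ 2 * ∑ k ∈ Finset.range (n + 1),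
      ∑ l ∈ Finset.range k, φ p.1 (gridNode t T n l) * φ p.2 (gridNode t T n k))) atTop
      (𝓝 (∑ p ∈ F, C p * C p)) :=
    tendsto_finsetSum _ fun p _ ↦
      (tendsto_iterated_riemann_sum htT (hφc p.1) (hφc p.2)).const_mul (C p)
  have h3 : Tendsto (fun n ↦ ∑ p ∈ F, ∑ r ∈ F, C p * C r *
        ((gridMesh t T n * ∑ l ∈ Finset.range (n + 1),
            φ p.1 (gridNode t T n l) * φ r.1 (gridNode t T n l)) *
          (gridMesh t T n * ∑ k ∈ Finset.range (n + 1),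
            φ p.2 (gridNode t T n k) * φ r.2 (gridNode t T n k)))) atTop
      (𝓝 (∑ p ∈ F, ∑ r ∈ F, C p * C r * ((if p.1 = r.1 then 1 else 0) *
        (if p.2 = r.2 then 1 else 0)))) := by
    refine tendsto_finsetSum _ fun p _ ↦ tendsto_finsetSum _ fun r _ ↦
      Tendsto.const_mul _ (Tendsto.mul ?_ ?_)
    · rw [← integral_legendrePhi_mul htT]
      exact tendsto_riemann_sum htT ((hφc _).mul (hφc _))
    · rw [← integral_legendrePhi_mul htT]
      exact tendsto_riemann_sum htT ((hφc _).mul (hφc _))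
  have hdiag : ∑ p ∈ F, ∑ r ∈ F, C p * C r * ((if p.1 = r.1 then 1 else 0) *
      (if p.2 = r.2 then 1 else 0)) = ∑ p ∈ F, C p * C p := by
    refine Finset.sum_congr rfl fun p hp ↦ ?_
    rw [Finset.sum_eq_single_of_mem p hp]
    · simp
    · intro r _ hrp
      by_cases h : p.1 = r.1
      · have h' : p.2 ≠ r.2 := fun h' ↦ hrp (Prod.ext h.symm h'.symm)
        simp [h']
      · simp [h]
  rw [hdiag] at h3
  simp only [expand]
  have := (h1.sub (h2.const_mul 2)).add h3
  convert! this using 2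
  simp only [sq (C _)]
  ring

/-- The mean square distance of the iterated integral from a partial sum of its expansion. The bound
for the Riemann sums is exact; it passes to the limit by Fatou's lemma. -/
theorem IsIteratedItoIntegral.eLpNorm_sub_le [IsProbabilityMeasure P]
    (hW : IsWienerProcess W 𝓕 S P) {i j : Fin m}
    (hij : i ≠ j) (ht : 0 ≤ t) (htT : t < T) (hTS : T ≤ S) {ζ : Fin m → ℕ → Ω → ℝ}
    (hζ : ∀ i j, IsItoIntegral 𝓕 P (W i) t T (fun s _ ↦ legendrePhi t T j s) (ζ i j))
    {X : Ω → ℝ} (hX : IsIteratedItoIntegral 𝓕 P (W i) (W j) t T X) (F : Finset (ℕ × ℕ)) :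
    eLpNorm (fun ω ↦ X ω - ∑ p ∈ F, triangleCoeff t T p * (ζ i p.1 ω * ζ j p.2 ω)) 2 P ≤
      ENNReal.ofReal √((T - t) ^ 2 / 2 - ∑ p ∈ F, triangleCoeff t T p ^ 2) := by
  classical
  have hXlim := hX.tendsto_iteratedGridSum hW i j ht htT hTS
  have hX2 : MemLp X 2 P := by
    obtain ⟨_, _, _, h⟩ := hX
    exact h.1
  have hgs := fun (i : Fin m) (k : ℕ) ↦
    (hζ i k).tendsto_gridSum hW i ht htT hTS (continuous_legendrePhi t T k)
  -- a common subsequence along which all Riemann sums converge almost surely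
  obtain ⟨ns, hns, hae⟩ := exists_subseq_forall_tendsto_ae (μ := P)
    (insert none ((F.image fun p ↦ some (i, p.1)) ∪ F.image fun p ↦ some (j, p.2)))
    (X := fun o : Option (Fin m × ℕ) ↦ o.elim (iteratedGridSum (W i) (W j) t T)
      fun r ↦ gridSum (W r.1) t T (legendrePhi t T r.2))
    (Y := fun o ↦ o.elim X fun r ↦ ζ r.1 r.2)
    (by
      rintro (_ | r) n
      · exact (memLp_iteratedGridSum hW i j ht htT hTS n).1
      · exact (memLp_gridSum hW r.1 ht htT hTS _ n).1)
    (by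
      rintro (_ | r)
      · exact hX2.1
      · exact (hζ r.1 r.2).1.1)
    (by
      rintro (_ | r) _
      · exact hXlim
      · exact hgs r.1 r.2)
  set D : ℕ → Ω → ℝ := fun n ω ↦ iteratedGridSum (W i) (W j) t T n ω -
    ∑ p ∈ F, triangleCoeff t T p * (gridSum (W i) t T (legendrePhi t T p.1) n ω *
      gridSum (W j) t T (legendrePhi t T p.2) n ω) with hD
  set Z : ℕ → ℕ × ℕ → Ω → ℝ := fun n q ω ↦
    gridIncrement (W i) t T n q.1 ω * gridIncrement (W j) t T n q.2 ω with hZ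
  set b : ℕ → ℕ × ℕ → ℝ := fun n q ↦ (if q.1 < q.2 then 1 else 0) -
    ∑ p ∈ F, triangleCoeff t T p * (legendrePhi t T p.1 (gridNode t T n q.1) *
      legendrePhi t T p.2 (gridNode t T n q.2)) with hb
  have hDZ : ∀ n, D n = fun ω ↦ ∑ q ∈ Finset.range (n + 1) ×ˢ Finset.range (n + 1),
      b n q * Z n q ω := fun n ↦ funext fun ω ↦ iteratedGridSum_sub_eq _ _ F _ n ω
  have hZ2 : ∀ n, ∀ q ∈ Finset.range (n + 1) ×ˢ Finset.range (n + 1), MemLp (Z n q) 2 P := by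
    intro n q hq
    rw [Finset.mem_product, Finset.mem_range, Finset.mem_range] at hq
    exact memLp_gridIncrement_mul hW hij ht htT hTS hq.1 hq.2
  have hD2 : ∀ n, MemLp (D n) 2 P := fun n ↦ by
    rw [hDZ]
    exact memLp_finsetSum _ fun q hq ↦ (hZ2 n q hq).const_mul _
  have hDnorm : ∀ n, eLpNorm (D n) 2 P = ENNReal.ofReal √(gridMesh t T n ^ 2 *
      ∑ q ∈ Finset.range (n + 1) ×ˢ Finset.range (n + 1), b n q ^ 2) := by
    intro n
    rw [(hD2 n).eLpNorm_two_eq_ofReal, hDZ, integral_sq_sum_of_orthogonal (hZ2 n)]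
    intro q hq r hr
    rw [Finset.mem_product, Finset.mem_range, Finset.mem_range] at hq hr
    exact integral_gridIncrement_mul_mul hW hij ht htT hTS hq.1 hr.1 hq.2 hr.2
  have hlim : Tendsto (fun k ↦ eLpNorm (D (ns k)) 2 P) atTop (𝓝 (ENNReal.ofReal
      √((T - t) ^ 2 / 2 - ∑ p ∈ F, triangleCoeff t T p ^ 2))) := by
    simp only [hDnorm]
    exact (ENNReal.tendsto_ofReal ((Real.continuous_sqrt.tendsto _).comp
      (tendsto_sum_sq_triangle_sub htT F))).comp hns.tendsto_atTop
  rw [← hlim.liminf_eq]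
  refine Lp.eLpNorm_lim_le_liminf_eLpNorm (fun k ↦ (hD2 (ns k)).1) _ ?_
  filter_upwards [hae] with ω hω
  refine (hω none (Finset.mem_insert_self _ _)).sub (tendsto_finsetSum _ fun p hp ↦
    Tendsto.const_mul _ (Tendsto.mul ?_ ?_))
  · exact hω (some (i, p.1)) (Finset.mem_insert_of_mem (Finset.mem_union_left _
      (Finset.mem_image_of_mem _ hp)))
  · exact hω (some (j, p.2)) (Finset.mem_insert_of_mem (Finset.mem_union_right _
      (Finset.mem_image_of_mem (fun p : ℕ × ℕ ↦ some (j, p.2)) hp)))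

/-- The index pairs `(0, 0)`, `(i - 1, i)` and `(i, i - 1)`, for `1 ≤ i ≤ n`. They carry all nonzero
Fourier coefficients of the triangle of order at most `n`. -/
def tridiagonal : ℕ → Finset (ℕ × ℕ)
  | 0 => {(0, 0)}
  | n + 1 => insert (n, n + 1) (insert (n + 1, n) (tridiagonal n))

theorem le_of_mem_tridiagonal {n : ℕ} {p : ℕ × ℕ} (hp : p ∈ tridiagonal n) :
    p.1 ≤ n ∧ p.2 ≤ n := by
  induction n with
  | zero => simp_all [tridiagonal]
  | succ n ih =>
    simp only [tridiagonal, Finset.mem_insert] at hp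
    rcases hp with rfl | rfl | hp
    · simp
    · simp
    · have := ih hp
      omega

theorem sum_tridiagonal_succ (n : ℕ) (f : ℕ × ℕ → ℝ) :
    ∑ p ∈ tridiagonal (n + 1), f p = f (n, n + 1) + (f (n + 1, n) + ∑ p ∈ tridiagonal n, f p) := by
  rw [tridiagonal, Finset.sum_insert, Finset.sum_insert]
  · intro h
    have := le_of_mem_tridiagonal h
    simp at this
  · intro h
    rcases Finset.mem_insert.1 h with h | h
    · simp at h
    · have := le_of_mem_tridiagonal h
      simp at this

/-- The sum of the squared coefficients telescopes. -/
theorem sum_triangleCoeff_sq (htT : t < T) (n : ℕ) :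
    ∑ p ∈ tridiagonal n, triangleCoeff t T p ^ 2 =
      (T - t) ^ 2 / 2 - (T - t) ^ 2 / (4 * (2 * (n : ℝ) + 1)) := by
  induction n with
  | zero =>
    simp only [tridiagonal, Finset.sum_singleton, triangleCoeff,
      integral_legendrePhi_zero_zero htT]
    push_cast
    ring
  | succ n ih =>
    have hpos : 0 < 4 * ((n : ℝ) + 1) ^ 2 - 1 := by nlinarith [(Nat.cast_nonneg n : (0 : ℝ) ≤ n)]
    rw [sum_tridiagonal_succ, ih]
    simp only [triangleCoeff, integral_legendrePhi_succ_left htT,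
      integral_legendrePhi_succ_right htT, neg_sq, mul_pow, div_pow, Real.sq_sqrt hpos.le]
    have e : 4 * ((n : ℝ) + 1) ^ 2 - 1 = (2 * (n : ℝ) + 1) * (2 * (n : ℝ) + 3) := by ring
    have e' : 2 * ((n + 1 : ℕ) : ℝ) + 1 = 2 * (n : ℝ) + 3 := by push_cast; ring
    rw [e, e']
    field_simp
    ring

theorem sum_tridiagonal_eq (htT : t < T) (x y : ℕ → ℝ) (n : ℕ) :
    ∑ p ∈ tridiagonal n, triangleCoeff t T p * (x p.1 * y p.2) =
      (T - t) / 2 * (x 0 * y 0 + ∑ i ∈ Finset.Icc 1 n, 1 / √(4 * (i : ℝ) ^ 2 - 1) *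
        (x (i - 1) * y i - x i * y (i - 1))) := by
  induction n with
  | zero => simp [tridiagonal, triangleCoeff, integral_legendrePhi_zero_zero htT]
  | succ n ih =>
    rw [sum_tridiagonal_succ, ih, Finset.sum_Icc_succ_top (by omega)]
    simp only [triangleCoeff, integral_legendrePhi_succ_left htT,
      integral_legendrePhi_succ_right htT, Nat.add_sub_cancel]
    push_cast
    ring

end Expansion

end

/-! ### Convergence of the expansions -/

section MeanSquare

variable {Ω : Type*} {mΩ : MeasurableSpace Ω} {P : Measure Ω}
  {𝓕 : Filtration ℝ mΩ} {m : ℕ} {W : Fin m → ℝ → Ω → ℝ} {S t T : ℝ}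

theorem IsMeanSquareLimit.sub_const_mul {R R' : ℕ → Ω → ℝ} {X X' : Ω → ℝ} (c : ℝ)
    (h : IsMeanSquareLimit P R X) (h' : IsMeanSquareLimit P R' X') :
    IsMeanSquareLimit P (fun n ω ↦ c * (R n ω - R' n ω)) (fun ω ↦ c * (X ω - X' ω)) := by
  refine ⟨fun n ↦ ((h.1 n).sub (h'.1 n)).const_mul c, (h.2.1.sub h'.2.1).const_mul c, ?_⟩
  have hlim : Tendsto (fun n ↦ ‖c‖ₑ * (eLpNorm (fun ω ↦ R n ω - X ω) 2 P +
      eLpNorm (fun ω ↦ R' n ω - X' ω) 2 P)) atTop (𝓝 0) := by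
    simpa using ENNReal.Tendsto.const_mul (a := ‖c‖ₑ) (h.2.2.add h'.2.2) (Or.inr (by simp))
  refine tendsto_of_tendsto_of_tendsto_of_le_of_le tendsto_const_nhds hlim
    (fun _ ↦ zero_le) fun n ↦ ?_
  have e : (fun ω ↦ c * (R n ω - R' n ω) - c * (X ω - X' ω)) =
      c • ((fun ω ↦ R n ω - X ω) - fun ω ↦ R' n ω - X' ω) := by
    ext ω
    simp only [Pi.smul_apply, Pi.sub_apply, smul_eq_mul]
    ring
  simp only [e]
  rw [eLpNorm_const_smul]
  gcongr
  exact MeasureTheory.eLpNorm_sub_le ((h.1 n).sub h.2.1).1 ((h'.1 n).sub h'.2.1).1 (by norm_num)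

/-- The expansion of the iterated integral. By `sum_triangleCoeff_sq`, the squared error of the
`n`-th partial sum is at most `(T - t)² / (4 (2n + 1))`. -/
theorem IsIteratedItoIntegral.isMeanSquareLimit [IsProbabilityMeasure P]
    (hW : IsWienerProcess W 𝓕 S P) {i j : Fin m} (hij : i ≠ j)
    (ht : 0 ≤ t) (htT : t < T) (hTS : T ≤ S) {ζ : Fin m → ℕ → Ω → ℝ}
    (hζ : ∀ i j, IsItoIntegral 𝓕 P (W i) t T (fun s _ ↦ legendrePhi t T j s) (ζ i j))
    (hind : iIndepFun (fun p : Fin m × ℕ ↦ ζ p.1 p.2) P)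
    {X : Ω → ℝ} (hX : IsIteratedItoIntegral 𝓕 P (W i) (W j) t T X) :
    IsMeanSquareLimit P
      (fun (n : ℕ) ω ↦ (T - t) / 2 * (ζ i 0 ω * ζ j 0 ω +
        ∑ k ∈ Finset.Icc 1 n, 1 / √(4 * (k : ℝ) ^ 2 - 1) *
          (ζ i (k - 1) ω * ζ j k ω - ζ i k ω * ζ j (k - 1) ω))) X := by
  have hsum : (fun (n : ℕ) ω ↦ (T - t) / 2 * (ζ i 0 ω * ζ j 0 ω +
        ∑ k ∈ Finset.Icc 1 n, 1 / √(4 * (k : ℝ) ^ 2 - 1) *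
          (ζ i (k - 1) ω * ζ j k ω - ζ i k ω * ζ j (k - 1) ω))) = fun n ω ↦
      ∑ p ∈ tridiagonal n, triangleCoeff t T p * (ζ i p.1 ω * ζ j p.2 ω) := by
    ext n ω
    exact (sum_tridiagonal_eq htT (fun k ↦ ζ i k ω) (fun k ↦ ζ j k ω) n).symm
  have hX2 : MemLp X 2 P := by
    obtain ⟨_, _, _, h⟩ := hX
    exact h.1
  rw [hsum]
  refine ⟨fun n ↦ memLp_finsetSum _ fun p _ ↦ MemLp.const_mul ?_ _, hX2, ?_⟩
  · exact (hind.indepFun (i := (i, p.1)) (j := (j, p.2)) (by simp [hij])).memLp_two_mul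
      (hζ i p.1).1 (hζ j p.2).1
  have hlim : Tendsto (fun n : ℕ ↦ ENNReal.ofReal √((T - t) ^ 2 / (4 * (2 * (n : ℝ) + 1))))
      atTop (𝓝 0) := by
    have h1 : Tendsto (fun n : ℕ ↦ (T - t) ^ 2 / (4 * (2 * (n : ℝ) + 1))) atTop (𝓝 0) := by
      refine tendsto_const_nhds.div_atTop (Tendsto.const_mul_atTop (by norm_num) ?_)
      exact tendsto_atTop_add_const_right _ _
        (tendsto_natCast_atTop_atTop.const_mul_atTop (by norm_num))
    simpa using ENNReal.tendsto_ofReal ((Real.continuous_sqrt.tendsto 0).comp h1)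
  refine tendsto_of_tendsto_of_tendsto_of_le_of_le tendsto_const_nhds hlim
    (fun _ ↦ zero_le) fun n ↦ ?_
  have h := hX.eLpNorm_sub_le hW hij ht htT hTS hζ (tridiagonal n)
  rw [sum_triangleCoeff_sq htT, sub_sub_cancel] at h
  refine le_trans (le_of_eq ?_) h
  exact eLpNorm_sub_comm (fun ω ↦ ∑ p ∈ tridiagonal n, triangleCoeff t T p *
    (ζ i p.1 ω * ζ j p.2 ω)) X 2 P

end MeanSquare

theorem mainTheorem2 {Ω : Type*} {mΩ : MeasurableSpace Ω} (P : Measure Ω) [IsProbabilityMeasure P]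
    (𝓕 : Filtration ℝ mΩ) {m : ℕ} (W : Fin m → ℝ → Ω → ℝ) (S t T : ℝ)
    (hW : IsWienerProcess W 𝓕 S P) (ht : 0 ≤ t) (htT : t < T) (hTS : T ≤ S)
    (ζ : Fin m → ℕ → Ω → ℝ) (hζ : ζ = fun i j ↦ legendreZeta 𝓕 P (W i) t T j) :
    -- the integrals `ζ_j^{(i)}` exist, and are independent standard Gaussian random variables
    (∀ i j, IsItoIntegral 𝓕 P (W i) t T (fun s _ ↦ legendrePhi t T j s) (ζ i j)) ∧
    (∀ i j, HasLaw (ζ i j) (gaussianReal 0 1) P) ∧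
    iIndepFun (fun p : Fin m × ℕ ↦ ζ p.1 p.2) P ∧
    ∀ i₁ i₂ : Fin m, i₁ ≠ i₂ →
      -- the iterated integral exists
      IsIteratedItoIntegral 𝓕 P (W i₁) (W i₂) t T
        (iteratedItoIntegral 𝓕 P (W i₁) (W i₂) t T) ∧
      -- the expansion of the iterated integral
      IsMeanSquareLimit P
        (fun n ω ↦ (T - t) / 2 * (ζ i₁ 0 ω * ζ i₂ 0 ω +
          ∑ i ∈ Finset.Icc 1 n, 1 / √(4 * (i : ℝ) ^ 2 - 1) *
            (ζ i₁ (i - 1) ω * ζ i₂ i ω - ζ i₁ i ω * ζ i₂ (i - 1) ω)))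
        (iteratedItoIntegral 𝓕 P (W i₁) (W i₂) t T) ∧
      -- the expansion of the Lévy stochastic area
      IsMeanSquareLimit P
        (fun n ω ↦ (T - t) / 2 *
          ∑ i ∈ Finset.Icc 1 n, 1 / √(4 * (i : ℝ) ^ 2 - 1) *
            (ζ i₁ (i - 1) ω * ζ i₂ i ω - ζ i₁ i ω * ζ i₂ (i - 1) ω))
        (levyArea 𝓕 P (W i₁) (W i₂) t T) := by
  subst hζ
  have hI : ∀ i j, IsItoIntegral 𝓕 P (W i) t T (fun s _ ↦ legendrePhi t T j s)
      (legendreZeta 𝓕 P (W i) t T j) := fun i j ↦ isItoIntegral_itoIntegral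
    (exists_isItoIntegral_deterministic hW i ht htT hTS (continuous_legendrePhi t T j))
  have hind : iIndepFun (fun p : Fin m × ℕ ↦ legendreZeta 𝓕 P (W p.1) t T p.2) P :=
    iIndepFun_iff_finset.2 fun F ↦ (hW.legendre_gaussian ht htT hTS hI F).2
  refine ⟨hI, fun i j ↦ ?_, hind, fun i₁ i₂ hne ↦ ?_⟩
  · exact (hW.legendre_gaussian ht htT hTS hI {(i, j)}).1 ⟨(i, j), Finset.mem_singleton_self _⟩
  have hJ : ∀ i j, IsIteratedItoIntegral 𝓕 P (W i) (W j) t T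
      (iteratedItoIntegral 𝓕 P (W i) (W j) t T) := fun i j ↦
    isIteratedItoIntegral_iteratedItoIntegral (exists_isIteratedItoIntegral hW i j ht htT hTS)
  have h₁₂ := (hJ i₁ i₂).isMeanSquareLimit hW hne ht htT hTS hI hind
  have h₂₁ := (hJ i₂ i₁).isMeanSquareLimit hW hne.symm ht htT hTS hI hind
  refine ⟨hJ i₁ i₂, h₁₂, ?_⟩
  -- the symmetric term cancels and the antisymmetric sum doubles
  have h := h₁₂.sub_const_mul (1 / 2) h₂₁
  convert! h using 3 with n ω
  have e : ∑ i ∈ Finset.Icc 1 n, 1 / √(4 * (i : ℝ) ^ 2 - 1) *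
      (legendreZeta 𝓕 P (W i₂) t T (i - 1) ω * legendreZeta 𝓕 P (W i₁) t T i ω -
        legendreZeta 𝓕 P (W i₂) t T i ω * legendreZeta 𝓕 P (W i₁) t T (i - 1) ω) =
      -∑ i ∈ Finset.Icc 1 n, 1 / √(4 * (i : ℝ) ^ 2 - 1) *
      (legendreZeta 𝓕 P (W i₁) t T (i - 1) ω * legendreZeta 𝓕 P (W i₂) t T i ω -
        legendreZeta 𝓕 P (W i₁) t T i ω * legendreZeta 𝓕 P (W i₂) t T (i - 1) ω) := by
    rw [← Finset.sum_neg_distrib]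
    exact Finset.sum_congr rfl fun i _ ↦ by ring
  rw [e]
  ring
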